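/- **Theorem 1.7.** For $t\in\mathbb R$ let $\|t\|$ be the distance from $t$ to the nearest integer. Let $n,m\ge 1$ be integers. For $\psi:\mathbb Z^n\to\mathbb R_{\ge 0}$ put $$\mathcal M^\times(n,m;\psi)=\Big\{\mathbf x=(\mathbf x_1,\dots,\mathbf x_m)\in([0,1]^n)^m:\ \prod_{j=1}^m\|\mathbf q\mathbf x_j\|<\psi(\mathbf q)\ \text{ for infinitely many }\mathbf q\in\mathbb Z^n\Big\},$$ where $\mathbf q\mathbf x_j=q_1x_{j,1}+\dots+q_nx_{j,n}$. Call $\psi$ non-increasing if $\psi(\mathbf q)\ge\psi(\mathbf q')$ whenever, for each $1\le\ell\le n$, either $0\le q_\ell\le q'_\ell$ or $q'_\ell\le q_\ell\le 0$. (In particular, this holds if $\psi(\mathbf q)\ge\psi(\mathbf q')$ whenever $|q_\ell|\le|q'_\ell|$ for all $\ell$.) Let $\mathcal L^{nm}$ be the $nm$-dimensional Lebesgue measure, and read $\psi(\mathbf q)\log^{m-1}(\psi(\mathbf q)^{-1})$ as $0$ where $\psi(\mathbf q)=0$. Series over $\mathbb Z^n$ are understood as unordered sums, so that convergence means absolute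 convergence. Let $\psi:\mathbb Z^n\to\mathbb R_{\ge 0}$ be non-increasing. 1. If $\psi(\mathbf q)<1$ for all but finitely many $\mathbf q$, and $\sum_{\mathbf q\in\mathbb Z^n}\psi(\mathbf q)\log^{m-1}(\psi(\mathbf q)^{-1})$ converges, then $\mathcal L^{nm}(\mathcal M^\times(n,m;\psi))=0$. 2. If $\sum_{\mathbf q\in\mathbb Z^n}\psi(\mathbf q)\log^{m-1}(\psi(\mathbf q)^{-1})$ diverges, then $\mathcal L^{nm}(\mathcal M^\times(n,m;\psi))=1$. Moreover, the Hussain–Simmons conjecture, which had $\psi(\mathbf q)^n$ in place of $\psi(\mathbf q)$ in the series, is false for all $n\ge2$ and $m\ge 1$: there is a non-increasing $\psi:\mathbb Z^n\to(0,1)$ such that $\sum_{\mathbf q\in\mathbb Z^n}\psi(\mathbf q)^n\log^{m-1}(\psi(\mathbf q)^{-1})$ converges, but $\mathcal L^{nm}(\mathcal M^\times(n,m;\psi))=1$. -/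

import Mathlib

open MeasureTheory

/-- The distance `‖t‖` of a real number `t` to the nearest integer. -/
noncomputable def distNearestInt (t : ℝ) : ℝ := |t - (round t : ℝ)|

/-- The real number `𝐪𝐲 = q₁ y₁ + ⋯ + qₙ yₙ` for `𝐪 ∈ ℤⁿ` and `𝐲 ∈ ℝⁿ`. -/
noncomputable def intForm {n : ℕ} (q : Fin n → ℤ) (y : Fin n → ℝ) : ℝ :=
  ∑ i, (q i : ℝ) * y i

/-- The set `ℳ^×(n,m;ψ)` of all `𝐱 = (𝐱₁, …, 𝐱ₘ) ∈ [0,1]^{nm}` (the column `𝐱ⱼ ∈ [0,1]ⁿ` is `x j`)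
such that `∏ⱼ ‖𝐪𝐱ⱼ‖ < ψ(𝐪)` for infinitely many `𝐪 ∈ ℤⁿ`. -/
def multSet (n m : ℕ) (ψ : (Fin n → ℤ) → ℝ) : Set (Fin m → Fin n → ℝ) :=
  {x | (∀ j i, x j i ∈ Set.Icc (0 : ℝ) 1) ∧
    {q : Fin n → ℤ | ∏ j, distNearestInt (intForm q (x j)) < ψ q}.Infinite}

/-- `ψ : ℤⁿ → ℝ` is non-increasing: it does not increase when coordinates move away from `0`
without changing sign, that is, it is non-increasing in each `|q_ℓ|` on each closed orthant. -/
def IsNonincreasing {n : ℕ} (ψ : (Fin n → ℤ) → ℝ) : Prop :=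
  ∀ q q' : Fin n → ℤ,
    (∀ l, (0 ≤ q l ∧ q l ≤ q' l) ∨ (q' l ≤ q l ∧ q l ≤ 0)) → ψ q' ≤ ψ q

open scoped Pointwise

/-! Put `d = m - 1`. The region of the unit cube where the product of the `m` coordinates is below a
small `t` consists, up to constants, of `log(1/t)^d` dyadic boxes of volume `t`; its volume is thus
comparable to `logWeight d t` (`pi_prodSublevel_le`, `le_pi_prodSublevel`). For `q ≠ 0` the map `x ↦
q x mod 1` preserves Lebesgue measure, so the terms of the series measure the events `∏ ‖q xⱼ‖ < ψ
q`. Convergence then gives measure zero by Borel–Cantelli; `IsNonincreasing.eventually_le_logCutoff`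
ensures that `ψ` is eventually small enough for the volume estimate.

For divergence one needs quasi-independence. It suffices to treat one orthant, whose vectors are `k
= g k'` with `k'` primitive. Forms with different primitive parts are independent. With a common
primitive part the question is one-dimensional: how close `y` is to fractions with denominators `g`.
Keeping only numerators coprime to `g` (`coprimeFract`) bounds every overlap by twice the product of
the lengths (`unitMeasure_coprimeFract_pair_le`). The price is a factor `(φ(g)/g)^m`, which is
bounded below on average because the weights are monotone (`sum_le_sum_coprimeRatio_pow`).
`kochen_stone` then yields positive measure (`multLimsup_pos`).

Positive measure becomes full measure by ergodicity of doubling on the torus. Since doubling at most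
doubles each `‖·‖`, this only gives full measure after multiplying the threshold by some constant
`K` (`iUnion_multLimsup_eq_one`). The constant is absorbed by starting from a threshold divided by
the partial sums of the series, which by `abel_dini` still diverges while being eventually smaller
than any multiple of the original (`multLimsup_eq_one`).

For the last claim, `∏ (2 + |qᵢ|)⁻¹` already diverges along one axis, whereas its `n`-th power with
logarithms is summable for `n ≥ 2`. -/

/-! ### The weight `t log(1/t)^d` -/

/-- The weight `t log(1/t)^d`. -/
noncomputable def logWeight (d : ℕ) (t : ℝ) : ℝ := t * Real.log t⁻¹ ^ d

lemma logWeight_zero (d : ℕ) : logWeight d 0 = 0 := by simp [logWeight]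

lemma log_inv_nonneg {t : ℝ} (h0 : 0 ≤ t) (h1 : t ≤ 1) : 0 ≤ Real.log t⁻¹ := by
  rw [Real.log_inv]; linarith [Real.log_nonpos h0 h1]

lemma logWeight_nonneg (d : ℕ) {t : ℝ} (h0 : 0 ≤ t) (h1 : t ≤ 1) : 0 ≤ logWeight d t :=
  mul_nonneg h0 (pow_nonneg (log_inv_nonneg h0 h1) d)

/-- The range `[0, logCutoff d]` on which the weight `t log(1/t)^d` is increasing. -/
noncomputable def logCutoff (d : ℕ) : ℝ := Real.exp (-(d + 2))

lemma logCutoff_pos (d : ℕ) : 0 < logCutoff d := Real.exp_pos _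

lemma logCutoff_lt_one (d : ℕ) : logCutoff d < 1 := by
  rw [logCutoff, Real.exp_lt_one_iff]
  have : (0 : ℝ) ≤ d := d.cast_nonneg
  linarith

lemma le_log_inv_of_le_logCutoff {d : ℕ} {t : ℝ} (h0 : 0 < t) (h : t ≤ logCutoff d) :
    (d : ℝ) + 2 ≤ Real.log t⁻¹ := by
  have := Real.log_le_log h0 h
  rw [logCutoff, Real.log_exp] at this
  rw [Real.log_inv]; linarith

lemma logWeight_mono (d : ℕ) {s t : ℝ} (hs : 0 ≤ s) (hst : s ≤ t) (ht : t ≤ logCutoff d) :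
    logWeight d s ≤ logWeight d t := by
  rcases hs.eq_or_lt with rfl | hs
  · rw [logWeight_zero]
    exact logWeight_nonneg d hst (ht.trans (logCutoff_lt_one d).le)
  have ht0 : 0 < t := hs.trans_le hst
  have hB := le_log_inv_of_le_logCutoff ht0 ht
  have hA := le_log_inv_of_le_logCutoff hs (hst.trans ht)
  unfold logWeight
  set A := Real.log s⁻¹ with hAdef
  set B := Real.log t⁻¹ with hBdef
  have hd : (0 : ℝ) ≤ d := d.cast_nonneg
  have hs' : s = Real.exp (-A) := by rw [hAdef, Real.log_inv, neg_neg, Real.exp_log hs]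
  have ht' : t = Real.exp (-B) := by rw [hBdef, Real.log_inv, neg_neg, Real.exp_log ht0]
  have hBA : B ≤ A := by
    rw [hAdef, hBdef, Real.log_inv, Real.log_inv]
    linarith [Real.log_le_log hs hst]
  have hB0 : 0 < B := by linarith
  have hA0 : 0 ≤ A := by linarith
  -- This is `1 + x ≤ exp x`. Raising to the power `d ≤ B` costs at most `exp (A - B)`, which is
  -- exactly `t / s`.
  have h1 : A ≤ B * Real.exp ((A - B) / B) := by
    have := Real.add_one_le_exp ((A - B) / B)
    calc A = B * ((A - B) / B + 1) := by field_simp; ring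
      _ ≤ _ := by gcongr
  have h2 : A ^ d ≤ B ^ d * Real.exp (A - B) := by
    calc A ^ d ≤ (B * Real.exp ((A - B) / B)) ^ d := by gcongr
      _ = B ^ d * Real.exp (d * ((A - B) / B)) := by rw [mul_pow, ← Real.exp_nat_mul]
      _ ≤ _ := by
        gcongr
        rw [← mul_div_assoc, div_le_iff₀ hB0]
        nlinarith
  calc s * A ^ d ≤ s * (B ^ d * Real.exp (A - B)) := by gcongr
    _ = t * B ^ d := by
      rw [hs', ht', mul_comm (B ^ d), ← mul_assoc, ← Real.exp_add]; ring_nf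

/-- Shrinking the argument only enlarges the logarithm. This transfers Abel–Dini divergence from
damped weights to weights of the damped threshold. -/
lemma mul_logWeight_le (d : ℕ) {r t : ℝ} (hr : 0 < r) (hr1 : r ≤ 1) (ht : 0 ≤ t) (ht1 : t ≤ 1) :
    r * logWeight d t ≤ logWeight d (r * t) := by
  rcases ht.eq_or_lt with rfl | ht
  · simp [logWeight_zero]
  unfold logWeight
  rw [← mul_assoc]
  have : Real.log t⁻¹ ≤ Real.log (r * t)⁻¹ := by
    rw [Real.log_inv, Real.log_inv, Real.log_mul hr.ne' ht.ne']
    linarith [Real.log_nonpos hr.le hr1]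
  have h0 := log_inv_nonneg ht.le ht1
  gcongr

/-! ### Dyadic scales and boxes -/

/-- For covering by `(K + 1)^d` boxes of volume `2^(-K)`; the shift by `d` pays for rounding `d`
coordinates to powers of two. -/
lemma exists_scale_upper (d : ℕ) {t : ℝ} (h0 : 0 < t) (h1 : t ≤ logCutoff d) :
    ∃ K : ℕ, t ≤ (1 / 2) ^ (K + d) ∧
      ((K : ℝ) + 1) ^ d * (1 / 2) ^ K ≤ 2 ^ (d + 1) * 3 ^ d * logWeight d t := by
  have hlog := le_log_inv_of_le_logCutoff h0 h1
  have hd : (0 : ℝ) ≤ d := d.cast_nonneg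
  have ht2 : t ≤ (1 / 2) ^ d := by
    calc t ≤ Real.exp (-(d + 2)) := h1
      _ ≤ Real.exp (d * (-Real.log 2)) := by
        have := Real.log_two_lt_d9
        gcongr
        nlinarith
      _ = (1 / 2) ^ d := by
        rw [Real.exp_nat_mul, Real.exp_neg, Real.exp_log (by norm_num)]; norm_num
  obtain ⟨N, hN1, hN2⟩ := exists_nat_pow_near_of_lt_one h0 (h1.trans (logCutoff_lt_one d).le)
    (by norm_num : (0 : ℝ) < 1 / 2) (by norm_num)
  have hdN : d ≤ N := by
    by_contra h
    push Not at h
    have : t ≤ (1 / 2) ^ (N + 1) :=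
      ht2.trans (pow_le_pow_of_le_one (by norm_num) (by norm_num) h)
    linarith
  obtain ⟨K, rfl⟩ := Nat.exists_eq_add_of_le' hdN
  refine ⟨K, hN2, ?_⟩
  have hK : ((K : ℝ) + 1) ≤ 3 * Real.log t⁻¹ := by
    have h3 : (K + d : ℝ) * Real.log 2 ≤ Real.log t⁻¹ := by
      have := Real.log_le_log h0 hN2
      rw [Real.log_pow, one_div, Real.log_inv] at this
      rw [Real.log_inv]
      push_cast at this
      linarith
    have := Real.log_two_gt_d9
    have hK0 : (0 : ℝ) ≤ K := K.cast_nonneg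
    nlinarith
  have hK2 : (1 / 2 : ℝ) ^ K ≤ 2 ^ (d + 1) * t := by
    have : (1 / 2 : ℝ) ^ K = 2 ^ (d + 1) * (1 / 2) ^ (K + d + 1) := by
      rw [add_assoc, pow_add _ K, mul_left_comm, ← mul_pow]; norm_num
    rw [this]
    gcongr
  have hl0 : 0 ≤ Real.log t⁻¹ := by linarith
  unfold logWeight
  calc ((K : ℝ) + 1) ^ d * (1 / 2) ^ K ≤ (3 * Real.log t⁻¹) ^ d * (2 ^ (d + 1) * t) := by gcongr
    _ = _ := by rw [mul_pow]; ring

lemma exists_scale_lower (d : ℕ) {t : ℝ} (h0 : 0 < t) (h1 : t ≤ 1) :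
    ∃ L : ℕ, (1 / 2) ^ L ≤ t ∧ logWeight d t ≤ 2 * ((1 / 2) ^ L * ((L : ℝ) + 1) ^ d) := by
  obtain ⟨N, hN1, hN2⟩ := exists_nat_pow_near_of_lt_one h0 h1
    (by norm_num : (0 : ℝ) < 1 / 2) (by norm_num)
  refine ⟨N + 1, hN1.le, ?_⟩
  have hl : Real.log t⁻¹ ≤ ((N + 1 : ℕ) : ℝ) + 1 := by
    have := Real.log_le_log (by positivity) hN1.le
    rw [Real.log_pow, one_div, Real.log_inv] at this
    rw [Real.log_inv]
    have h2 := Real.log_two_lt_d9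
    have hN : (0 : ℝ) ≤ ((N + 1 : ℕ) : ℝ) := Nat.cast_nonneg _
    nlinarith
  unfold logWeight
  have := log_inv_nonneg h0.le h1
  calc t * Real.log t⁻¹ ^ d ≤ (1 / 2) ^ N * (((N + 1 : ℕ) : ℝ) + 1) ^ d := by gcongr
    _ = _ := by rw [pow_succ]; ring

/-- Exponents of dyadic boxes in dimension `d + 1` of total at least `K`: the last `d` are free. -/
def boxExp {d : ℕ} (K : ℕ) (s : Fin d → ℕ) : Fin (d + 1) → ℕ := Fin.cons (K - ∑ i, s i) s

lemma le_sum_boxExp {d : ℕ} (K : ℕ) (s : Fin d → ℕ) : K ≤ ∑ j, boxExp K s j := by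
  rw [Fin.sum_univ_succ]; simp only [boxExp, Fin.cons_zero, Fin.cons_succ]; omega

lemma sum_boxExp {d : ℕ} (K : ℕ) (s : Fin d → ℕ) (h : ∑ i, s i ≤ K) :
    ∑ j, boxExp K s j = K := by
  rw [Fin.sum_univ_succ]; simp only [boxExp, Fin.cons_zero, Fin.cons_succ]; omega

/-- Round each of the last `d` coordinates up to a power of two, with exponent capped at `K`. If the
exponents already total `K`, nothing is asked of the first coordinate. Otherwise no cap is active,
each rounding loses at most a factor 2, and the product bound controls the first coordinate. -/
lemma exists_lt_boxExp {d : ℕ} (K : ℕ) {t : Fin (d + 1) → ℝ} (h0 : ∀ j, 0 ≤ t j)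
    (h1 : ∀ j, t j < 1) (h : ∏ j, t j < (1 / 2) ^ (K + d)) :
    ∃ s : Fin d → Fin (K + 1), ∀ j, t j < (1 / 2) ^ boxExp K (fun i => (s i : ℕ)) j := by
  classical
  let σ : Fin d → ℕ := fun i => Nat.findGreatest (fun a => t i.succ < (1 / 2) ^ a) K
  have hσK : ∀ i, σ i ≤ K := fun i => Nat.findGreatest_le K
  have hσ : ∀ i, t i.succ < (1 / 2) ^ σ i := fun i =>
    Nat.findGreatest_spec (P := fun a => t i.succ < (1 / 2) ^ a) (Nat.zero_le K)
      (by simpa using h1 i.succ)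
  refine ⟨fun i => ⟨σ i, Nat.lt_succ_of_le (hσK i)⟩, fun j => ?_⟩
  refine Fin.cases ?_ (fun i => ?_) j
  · simp only [boxExp, Fin.cons_zero]
    rcases le_or_gt K (∑ i, σ i) with hK | hK
    · rw [Nat.sub_eq_zero_of_le hK]; simpa using h1 0
    have hlt : ∀ i, σ i < K := fun i =>
      (Finset.single_le_sum (fun _ _ => Nat.zero_le _) (Finset.mem_univ i)).trans_lt hK
    have hge : ∀ i, (1 / 2 : ℝ) ^ (σ i + 1) ≤ t i.succ := fun i => by
      by_contra hc
      push Not at hc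
      have := Nat.le_findGreatest (P := fun a => t i.succ < (1 / 2) ^ a) (hlt i) hc
      change σ i + 1 ≤ σ i at this
      omega
    have hprod : (1 / 2 : ℝ) ^ (∑ i, σ i + d) ≤ ∏ i : Fin d, t i.succ := by
      calc (1 / 2 : ℝ) ^ (∑ i, σ i + d) = ∏ i : Fin d, (1 / 2 : ℝ) ^ (σ i + 1) := by
            rw [Finset.prod_pow_eq_pow_sum, Finset.sum_add_distrib]; simp
        _ ≤ _ := Finset.prod_le_prod (fun _ _ => by positivity) (fun i _ => hge i)
    rw [Fin.prod_univ_succ] at h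
    have h2 : t 0 * (1 / 2 : ℝ) ^ (∑ i, σ i + d) < (1 / 2) ^ (K + d) :=
      (mul_le_mul_of_nonneg_left hprod (h0 0)).trans_lt h
    have h3 : (1 / 2 : ℝ) ^ (K + d) = (1 / 2) ^ (K - ∑ i, σ i) * (1 / 2) ^ (∑ i, σ i + d) := by
      rw [← pow_add]; congr 1; omega
    rw [h3] at h2
    exact lt_of_mul_lt_mul_right h2 (by positivity)
  · simp only [boxExp, Fin.cons_succ]; exact hσ i

/-! ### The average of `φ(g)/g` over integer vectors with gcd `g` -/

/-- The proportion of residues modulo `g` that are coprime to `g`. -/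
noncomputable def coprimeRatio (g : ℕ) : ℝ := (Nat.totient g : ℝ) / g

lemma coprimeRatio_nonneg (g : ℕ) : 0 ≤ coprimeRatio g := by unfold coprimeRatio; positivity

/-- Isolate the divisor 1 in `∑ φ(g/e) = g` and bound the other terms by `g/e`. -/
lemma one_sub_coprimeRatio_le {g : ℕ} (hg : 0 < g) :
    1 - coprimeRatio g ≤ ∑ e ∈ g.divisors.erase 1, (1 : ℝ) / e := by
  have hsum : ∑ e ∈ g.divisors, (Nat.totient (g / e) : ℝ) = g := by
    have := (Nat.sum_div_divisors g Nat.totient).trans (Nat.sum_totient g)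
    exact_mod_cast this
  rw [← Finset.add_sum_erase _ _ (Nat.one_mem_divisors.2 hg.ne'), Nat.div_one] at hsum
  have hg' : (0 : ℝ) < g := by exact_mod_cast hg
  have hle : ∑ e ∈ g.divisors.erase 1, (Nat.totient (g / e) : ℝ)
      ≤ g * ∑ e ∈ g.divisors.erase 1, (1 : ℝ) / e := by
    rw [Finset.mul_sum]
    refine Finset.sum_le_sum fun e _ => ?_
    calc (Nat.totient (g / e) : ℝ) ≤ ((g / e : ℕ) : ℝ) := by exact_mod_cast Nat.totient_le _
      _ ≤ (g : ℝ) / e := Nat.cast_div_le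
      _ = _ := by ring
  have h2 : 1 - coprimeRatio g = (∑ e ∈ g.divisors.erase 1, (Nat.totient (g / e) : ℝ)) / g := by
    unfold coprimeRatio; field_simp; linarith
  rw [h2, div_le_iff₀ hg', mul_comm]
  exact hle

/-- The vectors of `{0, …, N}ⁿ` whose `l`-th coordinate is positive. -/
def posBox {n : ℕ} (l : Fin n) (N : ℕ) : Finset (Fin n → ℕ) :=
  (Fintype.piFinset fun _ => Finset.range (N + 1)).filter fun k => 1 ≤ k l

lemma mem_posBox {n : ℕ} {l : Fin n} {N : ℕ} {k : Fin n → ℕ} :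
    k ∈ posBox l N ↔ (∀ i, k i ≤ N) ∧ 1 ≤ k l := by
  simp [posBox]

lemma posBox_mono {n : ℕ} (l : Fin n) : Monotone (posBox l) := fun M N h k hk => by
  rw [mem_posBox] at hk ⊢
  exact ⟨fun i => (hk.1 i).trans h, hk.2⟩

/-- The greatest common divisor of the coordinates. -/
def vecGcd {n : ℕ} (k : Fin n → ℕ) : ℕ := Finset.univ.gcd k

lemma vecGcd_dvd {n : ℕ} (k : Fin n → ℕ) (i : Fin n) : vecGcd k ∣ k i :=
  Finset.gcd_dvd (Finset.mem_univ i)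

lemma vecGcd_pos {n : ℕ} {k : Fin n → ℕ} {l : Fin n} (h : 1 ≤ k l) : 0 < vecGcd k :=
  Nat.pos_of_dvd_of_pos (vecGcd_dvd k l) h

/-- Lowering the `l`-th coordinate of a multiple of `e` by `0, …, e - 1` gives `e` vectors where `F`
is at least as large. They stay in the box, and those from different multiples are distinct. -/
lemma mul_sum_dvd_le {n : ℕ} (l : Fin n) {F : (Fin n → ℕ) → ℝ} (hF : Antitone F)
    (h0 : ∀ k, 0 ≤ F k) (N e : ℕ) :
    e * ∑ k ∈ (posBox l N).filter (fun k => ∀ i, e ∣ k i), F k ≤ ∑ k ∈ posBox l N, F k := by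
  classical
  set A := (posBox l N).filter (fun k => ∀ i, e ∣ k i)
  let j : (Fin n → ℕ) × ℕ → (Fin n → ℕ) := fun p => Function.update p.1 l (p.1 l - p.2)
  have hlt : ∀ p ∈ A ×ˢ Finset.range e, p.2 < e ∧ e ∣ p.1 l ∧ e ≤ p.1 l := fun p hp => by
    rw [Finset.mem_product, Finset.mem_filter, mem_posBox, Finset.mem_range] at hp
    exact ⟨hp.2, hp.1.2 l, Nat.le_of_dvd hp.1.1.2 (hp.1.2 l)⟩
  have hinj : Set.InjOn j (A ×ˢ Finset.range e : Finset _) := by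
    rintro ⟨k, r⟩ hp ⟨k', r'⟩ hp' h
    obtain ⟨h1, ⟨a, ha⟩, h3⟩ := hlt _ hp
    obtain ⟨h1', ⟨a', ha'⟩, h3'⟩ := hlt _ hp'
    simp only at h1 ha h3 h1' ha' h3'
    have hl : k l - r = k' l - r' := by simpa [j] using congrFun h l
    have haa : a = a' := by
      rw [ha, ha'] at hl
      rw [ha] at h3
      rw [ha'] at h3'
      have hr : e * a + r' = e * a' + r := by omega
      rcases lt_trichotomy a a' with h | h | h
      · have := Nat.mul_le_mul_left e (Nat.succ_le_of_lt h)
        rw [Nat.mul_succ] at this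
        omega
      · exact h
      · have := Nat.mul_le_mul_left e (Nat.succ_le_of_lt h)
        rw [Nat.mul_succ] at this
        omega
    have hkl : k l = k' l := by rw [ha, ha', haa]
    have hr : r = r' := by omega
    have hk : k = k' := by
      funext i
      by_cases hi : i = l
      · rw [hi, hkl]
      · simpa [j, hi] using congrFun h i
    rw [hk, hr]
  calc (e : ℝ) * ∑ k ∈ A, F k = ∑ p ∈ A ×ˢ Finset.range e, F p.1 := by
        rw [Finset.sum_product, Finset.mul_sum]; simp
    _ ≤ ∑ p ∈ A ×ˢ Finset.range e, F (j p) := by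
        refine Finset.sum_le_sum fun p _ => hF fun i => ?_
        by_cases hi : i = l
        · subst hi; simp [j]
        · simp [j, hi]
    _ = ∑ k ∈ (A ×ˢ Finset.range e).image j, F k := (Finset.sum_image hinj).symm
    _ ≤ ∑ k ∈ posBox l N, F k := by
        refine Finset.sum_le_sum_of_subset_of_nonneg (fun k hk => ?_) fun _ _ _ => h0 _
        obtain ⟨p, hp, rfl⟩ := Finset.mem_image.1 hk
        have hp' := hlt p hp
        rw [Finset.mem_product, Finset.mem_filter, mem_posBox] at hp
        rw [mem_posBox]
        refine ⟨fun i => ?_, ?_⟩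
        · by_cases hi : i = l
          · subst hi; simpa [j] using (Nat.sub_le _ _).trans (hp.1.1.1 i)
          · simpa [j, hi] using hp.1.1.1 i
        · simp only [j, Function.update_self]; omega

lemma sum_inv_sq_le (N : ℕ) : ∑ e ∈ Finset.Icc 2 N, (1 : ℝ) / e ^ 2 ≤ 3 / 4 := by
  have key : ∀ M : ℕ, ∑ e ∈ Finset.Icc 2 (M + 2), (1 : ℝ) / e ^ 2 ≤ 3 / 4 - 1 / (M + 2) := by
    intro M
    induction M with
    | zero => norm_num
    | succ M ih =>
      rw [show M + 1 + 2 = (M + 2) + 1 by ring, Finset.sum_Icc_succ_top (by omega)]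
      push_cast
      have : (1 : ℝ) / (M + 2 + 1) ^ 2 ≤ 1 / (M + 2) - 1 / (M + 1 + 2) := by
        rw [div_sub_div _ _ (by positivity) (by positivity), div_le_div_iff₀ (by positivity)
          (by positivity)]
        nlinarith [(M.cast_nonneg : (0 : ℝ) ≤ M)]
      linarith
  rcases Nat.lt_or_ge N 2 with h | h
  · rw [Finset.Icc_eq_empty (by omega)]; norm_num
  · obtain ⟨M, rfl⟩ := Nat.exists_eq_add_of_le' h
    have : (0 : ℝ) ≤ 1 / (M + 2) := by positivity
    linarith [key M]

/-- The loss is at most `∑ 1/e` over common divisors `e ≥ 2`. Vectors divisible by `e` carry at most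
a fraction `1/e` of the sum, so the total loss is at most `∑ 1/e² ≤ 3/4` of it. -/
lemma sum_le_sum_coprimeRatio {n : ℕ} (l : Fin n) {F : (Fin n → ℕ) → ℝ} (hF : Antitone F)
    (h0 : ∀ k, 0 ≤ F k) (N : ℕ) :
    1 / 4 * ∑ k ∈ posBox l N, F k ≤ ∑ k ∈ posBox l N, coprimeRatio (vecGcd k) * F k := by
  classical
  set S := ∑ k ∈ posBox l N, F k with hS
  have hS0 : 0 ≤ S := Finset.sum_nonneg fun _ _ => h0 _
  have h1 : ∑ k ∈ posBox l N, (1 - coprimeRatio (vecGcd k)) * F k ≤ 3 / 4 * S := by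
    calc ∑ k ∈ posBox l N, (1 - coprimeRatio (vecGcd k)) * F k
        ≤ ∑ k ∈ posBox l N, ∑ e ∈ Finset.Icc 2 N,
            if ∀ i, e ∣ k i then (1 : ℝ) / e * F k else 0 := by
          refine Finset.sum_le_sum fun k hk => ?_
          rw [mem_posBox] at hk
          refine (mul_le_mul_of_nonneg_right
            (one_sub_coprimeRatio_le (vecGcd_pos hk.2)) (h0 k)).trans ?_
          rw [Finset.sum_mul, ← Finset.sum_filter]
          refine Finset.sum_le_sum_of_subset_of_nonneg (fun e he => ?_)
            fun e _ _ => mul_nonneg (by positivity) (h0 k)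
          rw [Finset.mem_erase, Nat.mem_divisors] at he
          have hd : ∀ i, e ∣ k i := fun i => he.2.1.trans (vecGcd_dvd k i)
          have hpos : 0 < e := Nat.pos_of_dvd_of_pos (hd l) hk.2
          have hle := (Nat.le_of_dvd hk.2 (hd l)).trans (hk.1 l)
          have := he.1
          rw [Finset.mem_filter, Finset.mem_Icc]
          exact ⟨⟨by omega, hle⟩, hd⟩
      _ = ∑ e ∈ Finset.Icc 2 N, (1 : ℝ) / e * ∑ k ∈ (posBox l N).filter (fun k => ∀ i, e ∣ k i),
            F k := by
          rw [Finset.sum_comm]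
          refine Finset.sum_congr rfl fun e _ => ?_
          rw [← Finset.sum_filter, Finset.mul_sum]
      _ ≤ ∑ e ∈ Finset.Icc 2 N, (1 : ℝ) / e ^ 2 * S := by
          refine Finset.sum_le_sum fun e he => ?_
          have he2 : 0 < (e : ℝ) := by
            have := (Finset.mem_Icc.1 he).1
            exact_mod_cast (by omega : 0 < e)
          have := mul_sum_dvd_le l hF h0 N e
          rw [← hS, mul_comm, ← le_div_iff₀ he2] at this
          calc _ ≤ (1 : ℝ) / e * (S / e) := by gcongr
            _ = _ := by field_simp
      _ ≤ 3 / 4 * S := by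
          rw [← Finset.sum_mul]
          exact mul_le_mul_of_nonneg_right (sum_inv_sq_le N) hS0
  have h2 : ∑ k ∈ posBox l N, (1 - coprimeRatio (vecGcd k)) * F k
      = S - ∑ k ∈ posBox l N, coprimeRatio (vecGcd k) * F k := by
    rw [hS, ← Finset.sum_sub_distrib]
    exact Finset.sum_congr rfl fun _ _ => by ring
  linarith

lemma sum_le_sum_coprimeRatio_pow {n : ℕ} (l : Fin n) {F : (Fin n → ℕ) → ℝ} (hF : Antitone F)
    (h0 : ∀ k, 0 ≤ F k) (N d : ℕ) :
    (1 / 8) ^ (d + 1) * ∑ k ∈ posBox l N, F k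
      ≤ ∑ k ∈ posBox l N, coprimeRatio (vecGcd k) ^ (d + 1) * F k := by
  -- A lower bound for the power that is linear in `w`, so that the average applies; `1/8` is half
  -- of the average bound `1/4`.
  have hw : ∀ w : ℝ, 0 ≤ w → (1 / 8) ^ d * (w - 1 / 8) ≤ w ^ (d + 1) := fun w hw => by
    rcases le_or_gt w (1 / 8) with h | h
    · have : (1 / 8 : ℝ) ^ d * (w - 1 / 8) ≤ 0 :=
        mul_nonpos_of_nonneg_of_nonpos (by positivity) (by linarith)
      exact this.trans (by positivity)
    · rw [pow_succ]
      have : (1 / 8 : ℝ) ^ d ≤ w ^ d := by gcongr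
      calc (1 / 8 : ℝ) ^ d * (w - 1 / 8) ≤ w ^ d * (w - 1 / 8) :=
            mul_le_mul_of_nonneg_right this (by linarith)
        _ ≤ w ^ d * w := by gcongr; linarith
  have h1 := sum_le_sum_coprimeRatio l hF h0 N
  calc (1 / 8 : ℝ) ^ (d + 1) * ∑ k ∈ posBox l N, F k
      ≤ (1 / 8) ^ d * ∑ k ∈ posBox l N, (coprimeRatio (vecGcd k) - 1 / 8) * F k := by
        rw [pow_succ, mul_assoc]
        refine mul_le_mul_of_nonneg_left ?_ (by positivity)
        simp only [sub_mul, Finset.sum_sub_distrib, ← Finset.mul_sum]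
        linarith
    _ = ∑ k ∈ posBox l N, ((1 / 8) ^ d * (coprimeRatio (vecGcd k) - 1 / 8)) * F k := by
        rw [Finset.mul_sum]; exact Finset.sum_congr rfl fun _ _ => by ring
    _ ≤ _ := Finset.sum_le_sum fun k _ =>
        mul_le_mul_of_nonneg_right (hw _ (coprimeRatio_nonneg _)) (h0 k)

/-! ### The Abel–Dini theorem -/

/-- The Abel–Dini theorem: dividing the terms of a divergent series by its partial sums leaves it
divergent. -/
lemma abel_dini {ι : Type*} {Q : ℕ → Finset ι} (hQ : Monotone Q) {rank : ι → ℕ}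
    (hrank : ∀ N, ∀ k ∈ Q N, rank k ≤ N) {F : ι → ℝ} (h0 : ∀ k, 0 ≤ F k)
    (hdiv : ∀ B : ℝ, ∃ N, B ≤ ∑ k ∈ Q N, F k) (B : ℝ) :
    ∃ N, B ≤ ∑ k ∈ Q N, (1 + ∑ i ∈ Q (rank k), F i)⁻¹ * F k := by
  classical
  set S : ℕ → ℝ := fun N => ∑ i ∈ Q N, F i with hS
  have hS0 : ∀ N, 0 ≤ S N := fun N => Finset.sum_nonneg fun _ _ => h0 _
  have hSm : Monotone S := fun M N h =>
    Finset.sum_le_sum_of_subset_of_nonneg (hQ h) fun _ _ _ => h0 _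
  -- Once the partial sum exceeds `2 * S M + 1`, the new terms, all with damping at least `(1 + S
  -- N)⁻¹`, contribute at least `1/2`.
  have hstep : ∀ M, ∃ N, ∑ k ∈ Q M, (1 + S (rank k))⁻¹ * F k + 1 / 2
      ≤ ∑ k ∈ Q N, (1 + S (rank k))⁻¹ * F k := by
    intro M
    obtain ⟨N, hN⟩ := hdiv (2 * S M + 1)
    change 2 * S M + 1 ≤ S N at hN
    have hMN : M ≤ N := by
      by_contra h
      push Not at h
      linarith [hSm h.le, hS0 M]
    refine ⟨N, ?_⟩
    rw [← Finset.sum_sdiff (hQ hMN), add_comm]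
    refine add_le_add_left ?_ _
    have hd : ∑ k ∈ Q N \ Q M, F k = S N - S M := by
      rw [eq_sub_iff_add_eq]; exact Finset.sum_sdiff (hQ hMN)
    calc (1 / 2 : ℝ) ≤ (1 + S N)⁻¹ * (S N - S M) := by
          rw [inv_mul_eq_div, le_div_iff₀ (by linarith [hS0 N])]; linarith
      _ = ∑ k ∈ Q N \ Q M, (1 + S N)⁻¹ * F k := by rw [← hd, Finset.mul_sum]
      _ ≤ _ := by
          refine Finset.sum_le_sum fun k hk => mul_le_mul_of_nonneg_right ?_ (h0 k)
          have h1 := hSm (hrank N k (Finset.mem_sdiff.1 hk).1)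
          have h2 := hS0 (rank k)
          gcongr
  have hall : ∀ j : ℕ, ∃ N, (j : ℝ) / 2 ≤ ∑ k ∈ Q N, (1 + S (rank k))⁻¹ * F k := by
    intro j
    induction j with
    | zero =>
      refine ⟨0, ?_⟩
      simp only [Nat.cast_zero, zero_div]
      exact Finset.sum_nonneg fun k _ =>
        mul_nonneg (inv_nonneg.2 (by linarith [hS0 (rank k)])) (h0 k)
    | succ j ih =>
      obtain ⟨M, hM⟩ := ih
      obtain ⟨N, hN⟩ := hstep M
      refine ⟨N, ?_⟩
      push_cast
      linarith
  obtain ⟨j, hj⟩ := exists_nat_ge (2 * B)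
  obtain ⟨N, hN⟩ := hall j
  exact ⟨N, by linarith⟩

/-! ### Approximation on the line by reduced fractions -/

/-- Lebesgue measure on `[0, 1)`. -/
noncomputable def unitMeasure : Measure ℝ := volume.restrict (Set.Ico 0 1)

instance : IsProbabilityMeasure unitMeasure := ⟨by simp [unitMeasure]⟩

/-- The fractional part of `g y` where the integer part is coprime to `g`, and `1` elsewhere. -/
noncomputable def coprimeFract (g : ℕ) (y : ℝ) : ℝ :=
  if Nat.Coprime ⌊(g : ℝ) * y⌋₊ g then Int.fract ((g : ℝ) * y) else 1

lemma coprimeFract_nonneg (g : ℕ) (y : ℝ) : 0 ≤ coprimeFract g y := by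
  unfold coprimeFract; split_ifs
  · exact Int.fract_nonneg _
  · exact zero_le_one

lemma fract_le_coprimeFract (g : ℕ) (y : ℝ) : Int.fract ((g : ℝ) * y) ≤ coprimeFract g y := by
  unfold coprimeFract; split_ifs
  · exact le_rfl
  · exact (Int.fract_lt_one _).le

lemma measurable_coprimeFract (g : ℕ) : Measurable (coprimeFract g) := by
  unfold coprimeFract
  refine Measurable.ite ?_ (by fun_prop) measurable_const
  have : Measurable fun y : ℝ => ⌊(g : ℝ) * y⌋₊ := Nat.measurable_floor.comp (by fun_prop)
  exact this (MeasurableSet.of_discrete (s := {p : ℕ | p.Coprime g}))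

lemma coprimeFract_eq_of_mem {g p : ℕ} (hg : 0 < g) (hp : p.Coprime g) {y : ℝ}
    (h1 : (p : ℝ) / g ≤ y) (h2 : y < (p + 1) / g) : coprimeFract g y = g * y - p := by
  have hg' : (0 : ℝ) < g := by exact_mod_cast hg
  rw [div_le_iff₀ hg', mul_comm] at h1
  rw [lt_div_iff₀ hg', mul_comm] at h2
  have hf : ⌊(g : ℝ) * y⌋₊ = p := (Nat.floor_eq_iff (p.cast_nonneg.trans h1)).2 ⟨h1, h2⟩
  rw [coprimeFract, if_pos (by rw [hf]; exact hp), Int.fract,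
    (Int.floor_eq_iff (z := (p : ℤ))).2 ⟨by exact_mod_cast h1, by exact_mod_cast h2⟩]
  simp

lemma exists_mem_Ico_of_coprimeFract_lt {g : ℕ} (hg : 0 < g) {y δ : ℝ} (hy : y ∈ Set.Ico (0 : ℝ) 1)
    (hδ : δ ≤ 1) (h : coprimeFract g y < δ) :
    ∃ p ∈ Finset.range g, p.Coprime g ∧ y ∈ Set.Ico ((p : ℝ) / g) ((p + δ) / g) := by
  have hg' : (0 : ℝ) < g := by exact_mod_cast hg
  have h0 : 0 ≤ (g : ℝ) * y := mul_nonneg hg'.le hy.1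
  unfold coprimeFract at h
  split_ifs at h with hc
  · refine ⟨⌊(g : ℝ) * y⌋₊, ?_, hc, ?_, ?_⟩
    · rw [Finset.mem_range, Nat.floor_lt h0]
      nlinarith [hy.2]
    · rw [div_le_iff₀ hg', mul_comm _ (g : ℝ)]; exact Nat.floor_le h0
    · rw [lt_div_iff₀ hg', mul_comm]
      have h1 : ((⌊(g : ℝ) * y⌋₊ : ℕ) : ℝ) = (⌊(g : ℝ) * y⌋ : ℝ) := natCast_floor_eq_intCast_floor h0
      rw [h1]
      linarith [Int.self_sub_floor ((g : ℝ) * y)]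
  · linarith

lemma le_unitMeasure_coprimeFract {g : ℕ} (hg : 0 < g) {α β : ℝ} (hα : 0 ≤ α) (hβ : β ≤ 1) :
    ENNReal.ofReal ((β - α) * coprimeRatio g)
      ≤ unitMeasure {y | α ≤ coprimeFract g y ∧ coprimeFract g y < β} := by
  have hg' : (0 : ℝ) < g := by exact_mod_cast hg
  set T := (Finset.range g).filter fun p => g.Coprime p with hT
  let I : ℕ → Set ℝ := fun p => Set.Ico ((p + α) / g) ((p + β) / g)
  have hdisj : Set.PairwiseDisjoint (T : Set ℕ) I := by
    intro p _ r _ hpr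
    refine Set.disjoint_left.2 fun y hy hy' => hpr ?_
    have h1 := hy.1; have h2 := hy.2; have h3 := hy'.1; have h4 := hy'.2
    rw [div_le_iff₀ hg'] at h1 h3
    rw [lt_div_iff₀ hg'] at h2 h4
    have h5 : (p : ℝ) < r + 1 := by linarith
    have h6 : (r : ℝ) < p + 1 := by linarith
    have h5' : p < r + 1 := by exact_mod_cast h5
    have h6' : r < p + 1 := by exact_mod_cast h6
    omega
  have hsub : (⋃ p ∈ T, I p) ⊆ {y | α ≤ coprimeFract g y ∧ coprimeFract g y < β} := by
    intro y hy
    simp only [Set.mem_iUnion] at hy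
    obtain ⟨p, hp, hy1, hy2⟩ := hy
    rw [hT, Finset.mem_filter] at hp
    have h := coprimeFract_eq_of_mem hg hp.2.symm (y := y)
      (le_trans (by gcongr; linarith) hy1) (hy2.trans_le (by gcongr))
    rw [div_le_iff₀ hg'] at hy1
    rw [lt_div_iff₀ hg'] at hy2
    refine ⟨?_, ?_⟩ <;> rw [h] <;> linarith
  have hsub01 : ∀ p ∈ T, I p ⊆ Set.Ico 0 1 := by
    intro p hp y hy
    rw [hT, Finset.mem_filter, Finset.mem_range] at hp
    have hp1 : (p : ℝ) + 1 ≤ g := by exact_mod_cast hp.1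
    refine ⟨le_trans (by positivity) hy.1, hy.2.trans_le ?_⟩
    rw [div_le_one hg']; linarith
  calc ENNReal.ofReal ((β - α) * coprimeRatio g)
      = ∑ p ∈ T, unitMeasure (I p) := by
        rw [Finset.sum_congr rfl (g := fun _ => ENNReal.ofReal ((β - α) / g))]
        · rw [Finset.sum_const, nsmul_eq_mul, ← ENNReal.ofReal_natCast,
            ← ENNReal.ofReal_mul (by positivity), coprimeRatio, Nat.totient, hT]
          congr 1; ring
        · intro p hp
          rw [unitMeasure, Measure.restrict_apply measurableSet_Ico,
            Set.inter_eq_left.2 (hsub01 p hp), Real.volume_Ico]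
          congr 1; field_simp; ring
    _ = unitMeasure (⋃ p ∈ T, I p) :=
        (measure_biUnion_finset hdisj fun _ _ => measurableSet_Ico).symm
    _ ≤ _ := measure_mono hsub

lemma unitMeasure_apply_le (s t : Set ℝ) (h : ∀ y ∈ Set.Ico (0 : ℝ) 1, y ∈ s → y ∈ t) :
    unitMeasure s ≤ volume t := by
  rw [unitMeasure, Measure.restrict_apply' measurableSet_Ico]
  exact measure_mono fun y hy => h y hy.2 hy.1

lemma unitMeasure_coprimeFract_lt_le {g : ℕ} (hg : 0 < g) {δ : ℝ} (hδ1 : δ ≤ 1) :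
    unitMeasure {y | coprimeFract g y < δ} ≤ ENNReal.ofReal δ := by
  have hg' : (0 : ℝ) < g := by exact_mod_cast hg
  calc unitMeasure {y | coprimeFract g y < δ}
      ≤ volume (⋃ p ∈ Finset.range g, Set.Ico ((p : ℝ) / g) ((p + δ) / g)) := by
        refine unitMeasure_apply_le _ _ fun y hy h => ?_
        obtain ⟨p, hp, -, hI⟩ := exists_mem_Ico_of_coprimeFract_lt hg hy hδ1 h
        simp only [Set.mem_iUnion]
        exact ⟨p, hp, hI⟩
    _ ≤ ∑ p ∈ Finset.range g, volume (Set.Ico ((p : ℝ) / g) ((p + δ) / g)) :=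
        measure_biUnion_finset_le _ _
    _ = ∑ p ∈ Finset.range g, ENNReal.ofReal (δ / g) := by
        refine Finset.sum_congr rfl fun p _ => ?_
        rw [Real.volume_Ico]; congr 1; ring
    _ = ENNReal.ofReal δ := by
        rw [Finset.sum_const, nsmul_eq_mul, ← ENNReal.ofReal_natCast, Finset.card_range,
          ← ENNReal.ofReal_mul (by positivity)]
        congr 1; field_simp

/-- With `g = gcd(a, b)`, the nonzero values of `p b - r a` in range are multiples of `g`, at most
`2 D / g` of them. Each value fixes `p` modulo `a / g`, leaving at most `g` choices of `p < a`, and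
then `r`. -/
lemma card_pairs_le {a b : ℕ} (ha : 0 < a) {D : ℝ} (hD : 0 ≤ D)
    (T : Finset (ℕ × ℕ)) (hT : ∀ x ∈ T, x.1 < a ∧ (x.1 : ℤ) * b - x.2 * a ≠ 0 ∧
      |((x.1 : ℝ) * b - x.2 * a)| < D) : (T.card : ℝ) ≤ 2 * D := by
  set g := a.gcd b with hg
  have hg0 : 0 < g := Nat.gcd_pos_of_pos_left b ha
  have hg' : (0 : ℝ) < g := by exact_mod_cast hg0
  obtain ⟨a', ha'⟩ : g ∣ a := Nat.gcd_dvd_left a b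
  obtain ⟨b', hb'⟩ : g ∣ b := Nat.gcd_dvd_right a b
  have hcop : Nat.Coprime a' b' := by
    have := Nat.coprime_div_gcd_div_gcd (m := a) (n := b) hg0
    rw [← hg] at this
    rwa [ha', hb', Nat.mul_div_cancel_left _ hg0, Nat.mul_div_cancel_left _ hg0] at this
  have ha0 : 0 < a' := Nat.pos_of_ne_zero fun h0 => by rw [h0] at ha'; omega
  set M : ℤ := ⌊D / g⌋ with hM
  have hM0 : 0 ≤ M := Int.floor_nonneg.2 (by positivity)
  let j : ℕ × ℕ → ℤ × ℕ := fun x => ((x.1 : ℤ) * b' - x.2 * a', x.1 / a')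
  have hmul : ∀ x : ℕ × ℕ, (x.1 : ℤ) * b - x.2 * a = g * ((x.1 : ℤ) * b' - x.2 * a') := by
    intro x; rw [ha', hb']; push_cast; ring
  have hmaps : ∀ x ∈ T, j x ∈ ((Finset.Icc (-M) M).erase 0) ×ˢ Finset.range g := by
    intro x hx
    obtain ⟨h1, h2, h3⟩ := hT x hx
    rw [hmul] at h2
    have h3' : |(((x.1 : ℤ) * b' - x.2 * a' : ℤ) : ℝ)| ≤ D / g := by
      rw [le_div_iff₀ hg']
      have : ((x.1 : ℝ) * b - x.2 * a) = (((x.1 : ℤ) * b' - x.2 * a' : ℤ) : ℝ) * g := by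
        have := congrArg (Int.cast : ℤ → ℝ) (hmul x)
        push_cast at this ⊢
        linarith
      rw [this, abs_mul, abs_of_pos hg'] at h3
      exact h3.le
    have h4 : |(x.1 : ℤ) * b' - x.2 * a'| ≤ M := by
      rw [hM, Int.le_floor]; push_cast at h3' ⊢; exact h3'
    rw [Finset.mem_product, Finset.mem_erase, Finset.mem_Icc, Finset.mem_range]
    refine ⟨⟨fun h => h2 (by rw [show ((x.1 : ℤ) * b' - x.2 * a') = 0 from h, mul_zero]),
      (abs_le.1 h4)⟩, ?_⟩
    rw [Nat.div_lt_iff_lt_mul ha0, ← ha']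
    exact h1
  have hinj : Set.InjOn j (T : Set (ℕ × ℕ)) := by
    rintro ⟨p, r⟩ _ ⟨p', r'⟩ _ h
    have h1 : (p : ℤ) * b' - r * a' = p' * b' - r' * a' := congrArg Prod.fst h
    have h2 : p / a' = p' / a' := congrArg Prod.snd h
    have h3 : (a' : ℤ) ∣ (p - p') * b' := ⟨r - r', by linarith⟩
    have h4 : (a' : ℤ) ∣ p - p' :=
      (Nat.isCoprime_iff_coprime.2 hcop).dvd_of_dvd_mul_right h3
    have h5 : p % a' = p' % a' := ((Nat.modEq_iff_dvd (n := a')).2 h4 : p' ≡ p [MOD a']).symm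
    have h6 : p = p' := by rw [← Nat.div_add_mod p a', ← Nat.div_add_mod p' a', h2, h5]
    subst h6
    have h7 : (r : ℤ) * a' = r' * a' := by linarith
    have h8 : (r : ℤ) = r' := mul_right_cancel₀ (by exact_mod_cast ha0.ne') h7
    have h9 : r = r' := by exact_mod_cast h8
    rw [h9]
  have hcard := Finset.card_le_card_of_injOn j hmaps hinj
  rw [Finset.card_product, Finset.card_range,
    Finset.card_erase_of_mem (Finset.mem_Icc.2 ⟨by omega, hM0⟩), Int.card_Icc] at hcard
  have hM2 : (((M + 1 - -M).toNat - 1 : ℕ) : ℤ) = 2 * M := by omega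
  have hM3 : (M : ℝ) ≤ D / g := Int.floor_le _
  rw [le_div_iff₀ hg'] at hM3
  have h1 : (((M + 1 - -M).toNat - 1 : ℕ) : ℝ) = 2 * M := by exact_mod_cast hM2
  calc (T.card : ℝ) ≤ (((M + 1 - -M).toNat - 1 : ℕ) : ℝ) * g := by exact_mod_cast hcard
    _ ≤ 2 * D := by rw [h1]; linarith

lemma eq_of_coprime_of_cross_eq {a b p r : ℕ} (hp : p.Coprime a) (hr : r.Coprime b)
    (h : p * b = r * a) : a = b := by
  refine Nat.dvd_antisymm ?_ ?_
  · exact hp.symm.dvd_of_dvd_mul_left ⟨r, by rw [h, mul_comm]⟩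
  · exact hr.symm.dvd_of_dvd_mul_left ⟨p, by rw [← h, mul_comm]⟩

/-- Intervals at `p/a` and `r/b` can meet only if `|p b - r a| < D`. Coprimality excludes the value
zero, which would force `a = b`, and so removes the only overlaps that could break independence. -/
lemma unitMeasure_coprimeFract_pair_le {a b : ℕ} (ha : 0 < a) (hb : 0 < b) (hab : a ≠ b)
    {δ ε : ℝ} (hδ0 : 0 ≤ δ) (hδ : δ ≤ 1) (hε0 : 0 ≤ ε) (hε : ε ≤ 1) :
    unitMeasure {y | coprimeFract a y < δ ∧ coprimeFract b y < ε}
      ≤ ENNReal.ofReal (2 * δ * ε) := by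
  classical
  have ha' : (0 : ℝ) < a := by exact_mod_cast ha
  have hb' : (0 : ℝ) < b := by exact_mod_cast hb
  set D := max (δ * b) (ε * a) with hD
  have hD0 : 0 ≤ D := le_max_of_le_left (by positivity)
  set m := min (δ * b) (ε * a) with hm
  set T := (Finset.range a ×ˢ Finset.range b).filter fun x =>
    (x.1 : ℤ) * b - x.2 * a ≠ 0 ∧ |((x.1 : ℝ) * b - x.2 * a)| < D with hT
  let I : ℕ × ℕ → Set ℝ := fun x =>
    Set.Ico ((x.1 : ℝ) / a) ((x.1 + δ) / a) ∩ Set.Ico ((x.2 : ℝ) / b) ((x.2 + ε) / b)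
  have hvol : ∀ x, volume (I x) ≤ ENNReal.ofReal (m / (a * b)) := by
    intro x
    rcases le_total (δ * b) (ε * a) with h | h
    · rw [hm, min_eq_left h]
      refine (measure_mono Set.inter_subset_left).trans ?_
      rw [Real.volume_Ico]
      refine le_of_eq (congrArg _ ?_); field_simp; ring
    · rw [hm, min_eq_right h]
      refine (measure_mono Set.inter_subset_right).trans ?_
      rw [Real.volume_Ico]
      refine le_of_eq (congrArg _ ?_); field_simp; ring
  calc unitMeasure {y | coprimeFract a y < δ ∧ coprimeFract b y < ε}
      ≤ volume (⋃ x ∈ T, I x) := by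
        refine unitMeasure_apply_le _ _ fun y hy h => ?_
        obtain ⟨p, hp, hpa, hI⟩ := exists_mem_Ico_of_coprimeFract_lt ha hy hδ h.1
        obtain ⟨r, hr, hrb, hJ⟩ := exists_mem_Ico_of_coprimeFract_lt hb hy hε h.2
        simp only [Set.mem_iUnion]
        refine ⟨(p, r), ?_, hI, hJ⟩
        rw [hT, Finset.mem_filter, Finset.mem_product]
        refine ⟨⟨hp, hr⟩, fun h0 => hab ?_, ?_⟩
        · have : (p : ℤ) * b = r * a := by simpa [sub_eq_zero] using h0
          exact eq_of_coprime_of_cross_eq hpa hrb (by exact_mod_cast this)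
        · have h1 := hI.1; have h2 := hI.2; have h3 := hJ.1; have h4 := hJ.2
          rw [div_le_iff₀ ha'] at h1
          rw [lt_div_iff₀ ha'] at h2
          rw [div_le_iff₀ hb'] at h3
          rw [lt_div_iff₀ hb'] at h4
          have h5 : δ * b ≤ D := le_max_left _ _
          have h6 : ε * a ≤ D := le_max_right _ _
          simp only [abs_lt]
          constructor <;> nlinarith
    _ ≤ ∑ x ∈ T, volume (I x) := measure_biUnion_finset_le _ _
    _ ≤ ∑ x ∈ T, ENNReal.ofReal (m / (a * b)) := Finset.sum_le_sum fun x _ => hvol x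
    _ = ENNReal.ofReal (T.card * (m / (a * b))) := by
        rw [Finset.sum_const, nsmul_eq_mul, ← ENNReal.ofReal_natCast,
          ← ENNReal.ofReal_mul (by positivity)]
    _ ≤ ENNReal.ofReal (2 * δ * ε) := by
        refine ENNReal.ofReal_le_ofReal ?_
        have hcard : (T.card : ℝ) ≤ 2 * D := by
          refine card_pairs_le (b := b) ha hD0 T fun x hx => ?_
          rw [hT, Finset.mem_filter, Finset.mem_product, Finset.mem_range] at hx
          exact ⟨hx.1.1, hx.2⟩
        have hm0 : 0 ≤ m := le_min (by positivity) (by positivity)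
        calc (T.card : ℝ) * (m / (a * b)) ≤ 2 * D * (m / (a * b)) := by gcongr
          _ = 2 * (m * D) / (a * b) := by ring
          _ = 2 * δ * ε := by
            -- The minimum bounds an overlap and the maximum the number of overlaps; their product
            -- is `δ b ε a`.
            rw [hm, hD, min_mul_max]; field_simp

/-! ### Integer linear forms on the torus -/

/-- The uniform measure on the unit cube of `ℝⁿ`. -/
noncomputable def cubeMeasure (n : ℕ) : Measure (Fin n → ℝ) := Measure.pi fun _ => unitMeasure

instance (n : ℕ) : IsProbabilityMeasure (cubeMeasure n) := by
  unfold cubeMeasure; infer_instance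

instance : IsProbabilityMeasure (volume : Measure UnitAddCircle) := ⟨UnitAddCircle.measure_univ⟩

lemma measurePreserving_coe_circle :
    MeasurePreserving ((↑) : ℝ → UnitAddCircle) unitMeasure volume := by
  have := UnitAddCircle.measurePreserving_mk 0
  rwa [zero_add, ← Measure.restrict_congr_set Ico_ae_eq_Ioc] at this

/-- The representative in `[0, 1)` of a point of the circle. -/
noncomputable def circleRep (y : UnitAddCircle) : ℝ := (AddCircle.equivIco 1 0 y : ℝ)

lemma circleRep_coe (x : ℝ) : circleRep (x : UnitAddCircle) = Int.fract x := by
  have := AddCircle.coe_equivIco_mk_apply (1 : ℝ) x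
  rw [div_one, mul_one] at this
  exact this

lemma measurable_circleRep : Measurable circleRep :=
  measurable_subtype_coe.comp (AddCircle.measurableEquivIco 1 0).measurable

lemma measurePreserving_circleRep : MeasurePreserving circleRep volume unitMeasure := by
  refine ⟨measurable_circleRep, ?_⟩
  rw [← measurePreserving_coe_circle.map_eq,
    Measure.map_map measurable_circleRep measurePreserving_coe_circle.measurable]
  have h : circleRep ∘ ((↑) : ℝ → UnitAddCircle) =ᵐ[unitMeasure] id := by
    rw [unitMeasure, Filter.EventuallyEq, ae_restrict_iff' measurableSet_Ico]
    refine Filter.Eventually.of_forall fun x hx => ?_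
    rw [Function.comp_apply, circleRep_coe, id, Int.fract_eq_self.2 hx]
  rw [Measure.map_congr h, Measure.map_id]

/-- The integer linear form `∑ qᵢ yᵢ` on the torus. -/
noncomputable def torusForm {n : ℕ} (q : Fin n → ℤ) : (Fin n → UnitAddCircle) →+ UnitAddCircle :=
  ∑ i, q i • Pi.evalAddMonoidHom (fun _ => UnitAddCircle) i

lemma torusForm_apply {n : ℕ} (q : Fin n → ℤ) (y : Fin n → UnitAddCircle) :
    torusForm q y = ∑ i, q i • y i := by
  simp [torusForm]

lemma torusForm_coe {n : ℕ} (q : Fin n → ℤ) (x : Fin n → ℝ) :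
    torusForm q (fun i => (x i : UnitAddCircle)) = (intForm q x : ℝ) := by
  rw [torusForm_apply, intForm]
  refine Eq.trans ?_ (map_sum (QuotientAddGroup.mk' (AddSubgroup.zmultiples (1 : ℝ))) _ _).symm
  refine Finset.sum_congr rfl fun i _ => ?_
  rw [← zsmul_eq_mul]
  exact (AddCircle.coe_zsmul (p := (1 : ℝ))).symm

lemma continuous_torusForm {n : ℕ} (q : Fin n → ℤ) : Continuous (torusForm q) := by
  have : (torusForm q : (Fin n → UnitAddCircle) → UnitAddCircle) = fun y => ∑ i, q i • y i :=
    funext (torusForm_apply q)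
  rw [this]
  fun_prop

lemma measurePreserving_coe_torus (n : ℕ) :
    MeasurePreserving (fun (x : Fin n → ℝ) i => (x i : UnitAddCircle)) (cubeMeasure n) volume :=
  measurePreserving_pi _ _ fun _ => measurePreserving_coe_circle

lemma surjective_torusForm {n : ℕ} {q : Fin n → ℤ} {i : Fin n} (hi : q i ≠ 0) :
    Function.Surjective (torusForm q) := by
  intro y
  induction y using QuotientAddGroup.induction_on with
  | H t =>
    refine ⟨fun j => ((Pi.single i (t / q i) : Fin n → ℝ) j : UnitAddCircle), ?_⟩
    rw [torusForm_coe, intForm, Finset.sum_eq_single i (fun j _ hj => by simp [hj]) (by simp)]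
    have : (q i : ℝ) ≠ 0 := by exact_mod_cast hi
    rw [Pi.single_eq_same, mul_div_cancel₀ _ this]

/-- Cramer's rule in the coordinates `i` and `j`, with all other coordinates zero. -/
lemma surjective_torusForm_prod {n : ℕ} {q q' : Fin n → ℤ} {i j : Fin n}
    (h : q i * q' j - q j * q' i ≠ 0) :
    Function.Surjective ((torusForm q).prod (torusForm q')) := by
  rintro ⟨y, y'⟩
  have hij : i ≠ j := by rintro rfl; exact h (by ring)
  induction y using QuotientAddGroup.induction_on with
  | H t =>
    induction y' using QuotientAddGroup.induction_on with
    | H t' =>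
      set Δ : ℝ := (q i : ℝ) * q' j - q j * q' i with hΔ
      have hΔ0 : Δ ≠ 0 := by rw [hΔ]; exact_mod_cast h
      let x : Fin n → ℝ := Pi.single i ((t * q' j - t' * q j) / Δ) +
        Pi.single j ((t' * q i - t * q' i) / Δ)
      have hx : ∀ r : Fin n → ℤ, intForm r x
          = r i * ((t * q' j - t' * q j) / Δ) + r j * ((t' * q i - t * q' i) / Δ) := by
        intro r
        simp only [intForm, x, Pi.add_apply, mul_add, Finset.sum_add_distrib]
        rw [Finset.sum_eq_single i (fun j _ hj => by simp [hj]) (by simp),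
          Finset.sum_eq_single j (fun j _ hj => by simp [hj]) (by simp)]
        simp
      refine ⟨fun l => (x l : UnitAddCircle), ?_⟩
      rw [AddMonoidHom.prod_apply, torusForm_coe, torusForm_coe, hx, hx]
      have h1 : (q i : ℝ) * ((t * q' j - t' * q j) / Δ) + q j * ((t' * q i - t * q' i) / Δ) = t := by
        field_simp; rw [hΔ]; ring
      have h2 : (q' i : ℝ) * ((t * q' j - t' * q j) / Δ) + q' j * ((t' * q i - t * q' i) / Δ) = t' := by
        field_simp; rw [hΔ]; ring
      rw [h1, h2]

/-- A continuous surjective homomorphism of compact groups carries normalized Haar measure to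
normalized Haar measure. -/
lemma measurePreserving_fract_intForm {n : ℕ} {q : Fin n → ℤ} {i : Fin n} (hi : q i ≠ 0) :
    MeasurePreserving (fun x => Int.fract (intForm q x)) (cubeMeasure n) unitMeasure := by
  have h1 : MeasurePreserving (torusForm q) volume volume :=
    (torusForm q).measurePreserving (continuous_torusForm q) (surjective_torusForm hi) (by simp)
  have h := measurePreserving_circleRep.comp (h1.comp (measurePreserving_coe_torus n))
  convert h using 1
  funext x
  simp only [Function.comp_apply, torusForm_coe, circleRep_coe]

lemma measurePreserving_fract_intForm_prod {n : ℕ} {q q' : Fin n → ℤ} {i j : Fin n}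
    (h : q i * q' j - q j * q' i ≠ 0) :
    MeasurePreserving (fun x => (Int.fract (intForm q x), Int.fract (intForm q' x)))
      (cubeMeasure n) (unitMeasure.prod unitMeasure) := by
  have h1 : MeasurePreserving ((torusForm q).prod (torusForm q')) volume
      ((volume : Measure UnitAddCircle).prod volume) :=
    ((torusForm q).prod (torusForm q')).measurePreserving
      ((continuous_torusForm q).prodMk (continuous_torusForm q')) (surjective_torusForm_prod h)
      (by simp)
  have h := (measurePreserving_circleRep.prod measurePreserving_circleRep).comp
    (h1.comp (measurePreserving_coe_torus n))
  convert h using 1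
  funext x
  simp only [Function.comp_apply, torusForm_coe, circleRep_coe, AddMonoidHom.prod_apply,
    Prod.map_apply]

/-! ### Volume of multiplicative sublevel sets -/

/-- The points whose `u`-values all lie below `1` and have product below `t`. -/
def prodSublevel {α : Type*} {m : ℕ} (u : α → ℝ) (t : ℝ) : Set (Fin m → α) :=
  {x | (∀ j, u (x j) < 1) ∧ ∏ j, u (x j) < t}

lemma measurableSet_prodSublevel {α : Type*} [MeasurableSpace α] {m : ℕ} {u : α → ℝ}
    (hu : Measurable u) (t : ℝ) : MeasurableSet (prodSublevel (m := m) u t) := by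
  unfold prodSublevel
  measurability

lemma prod_half_pow_boxExp_le {d : ℕ} (K : ℕ) (s : Fin d → ℕ) :
    ∏ j, (1 / 2 : ℝ) ^ boxExp K s j ≤ (1 / 2) ^ K := by
  rw [Finset.prod_pow_eq_pow_sum]
  exact pow_le_pow_of_le_one (by norm_num) (by norm_num) (le_sum_boxExp K s)

lemma pi_prodSublevel_le {α : Type*} [MeasurableSpace α] (μ : Measure α) [SigmaFinite μ] {d : ℕ}
    {u : α → ℝ} (hu0 : ∀ x, 0 ≤ u x) {C : ℝ} (hC : 0 ≤ C)
    (hu : ∀ a : ℕ, μ {x | u x < (1 / 2) ^ a} ≤ ENNReal.ofReal (C * (1 / 2) ^ a))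
    {t : ℝ} (h0 : 0 < t) (h1 : t ≤ logCutoff d) :
    Measure.pi (fun _ : Fin (d + 1) => μ) (prodSublevel u t)
      ≤ ENNReal.ofReal (C ^ (d + 1) * (2 ^ (d + 1) * 3 ^ d) * logWeight d t) := by
  obtain ⟨K, hK1, hK2⟩ := exists_scale_upper d h0 h1
  let box : (Fin d → Fin (K + 1)) → Set (Fin (d + 1) → α) := fun s =>
    Set.univ.pi fun j => {x | u x < (1 / 2) ^ boxExp K (fun i => (s i : ℕ)) j}
  have hbox : ∀ s, Measure.pi (fun _ : Fin (d + 1) => μ) (box s)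
      ≤ ENNReal.ofReal (C ^ (d + 1) * (1 / 2) ^ K) := by
    intro s
    rw [Measure.pi_pi]
    refine (Finset.prod_le_prod' fun j _ => hu _).trans ?_
    rw [← ENNReal.ofReal_prod_of_nonneg fun _ _ => by positivity, Finset.prod_mul_distrib]
    refine ENNReal.ofReal_le_ofReal ?_
    rw [Finset.prod_const, Finset.card_univ, Fintype.card_fin]
    exact mul_le_mul_of_nonneg_left (prod_half_pow_boxExp_le K _) (by positivity)
  calc Measure.pi (fun _ : Fin (d + 1) => μ) (prodSublevel u t)
      ≤ Measure.pi (fun _ : Fin (d + 1) => μ) (⋃ s ∈ Finset.univ, box s) := by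
        refine measure_mono fun x hx => ?_
        obtain ⟨s, hs⟩ := exists_lt_boxExp K (t := fun j => u (x j)) (fun j => hu0 _) hx.1
          (hx.2.trans_le hK1)
        simp only [Set.mem_iUnion]
        exact ⟨s, Finset.mem_univ _, fun j _ => hs j⟩
    _ ≤ ∑ s, ENNReal.ofReal (C ^ (d + 1) * (1 / 2) ^ K) :=
        (measure_biUnion_finset_le _ _).trans (Finset.sum_le_sum fun s _ => hbox s)
    _ = ENNReal.ofReal (((K : ℝ) + 1) ^ d * (C ^ (d + 1) * (1 / 2) ^ K)) := by
        rw [Finset.sum_const, nsmul_eq_mul, ← ENNReal.ofReal_natCast,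
          ← ENNReal.ofReal_mul (by positivity)]
        simp
    _ ≤ _ := by
        refine ENNReal.ofReal_le_ofReal ?_
        have : 0 ≤ C ^ (d + 1) := by positivity
        calc _ = C ^ (d + 1) * (((K : ℝ) + 1) ^ d * (1 / 2) ^ K) := by ring
          _ ≤ C ^ (d + 1) * (2 ^ (d + 1) * 3 ^ d * logWeight d t) := by gcongr
          _ = _ := by ring

/-- Cover both sets by dyadic boxes. A pair of boxes meets in a product over the coordinates, so the
one-coordinate overlap bound passes to `d + 1` coordinates. -/
lemma pi_prodSublevel_inter_le {α : Type*} [MeasurableSpace α] (μ : Measure α) [SigmaFinite μ]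
    {d : ℕ} {u v : α → ℝ} (hu0 : ∀ x, 0 ≤ u x) (hv0 : ∀ x, 0 ≤ v x) {C : ℝ} (hC : 0 ≤ C)
    (huv : ∀ a b : ℕ, μ {x | u x < (1 / 2) ^ a ∧ v x < (1 / 2) ^ b}
      ≤ ENNReal.ofReal (C * (1 / 2) ^ a * (1 / 2) ^ b))
    {t t' : ℝ} (h0 : 0 < t) (h1 : t ≤ logCutoff d) (h0' : 0 < t') (h1' : t' ≤ logCutoff d) :
    Measure.pi (fun _ : Fin (d + 1) => μ) (prodSublevel u t ∩ prodSublevel v t')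
      ≤ ENNReal.ofReal (C ^ (d + 1) * (2 ^ (d + 1) * 3 ^ d) ^ 2
        * (logWeight d t * logWeight d t')) := by
  obtain ⟨K, hK1, hK2⟩ := exists_scale_upper d h0 h1
  obtain ⟨K', hK1', hK2'⟩ := exists_scale_upper d h0' h1'
  let box : (Fin d → Fin (K + 1)) × (Fin d → Fin (K' + 1)) → Set (Fin (d + 1) → α) := fun s =>
    Set.univ.pi fun j => {x | u x < (1 / 2) ^ boxExp K (fun i => (s.1 i : ℕ)) j ∧
      v x < (1 / 2) ^ boxExp K' (fun i => (s.2 i : ℕ)) j}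
  have hbox : ∀ s, Measure.pi (fun _ : Fin (d + 1) => μ) (box s)
      ≤ ENNReal.ofReal (C ^ (d + 1) * ((1 / 2) ^ K * (1 / 2) ^ K')) := by
    intro s
    rw [Measure.pi_pi]
    refine (Finset.prod_le_prod' fun j _ => huv _ _).trans ?_
    rw [← ENNReal.ofReal_prod_of_nonneg fun _ _ => by positivity, Finset.prod_mul_distrib,
      Finset.prod_mul_distrib]
    refine ENNReal.ofReal_le_ofReal ?_
    rw [Finset.prod_const, Finset.card_univ, Fintype.card_fin, mul_assoc]
    exact mul_le_mul_of_nonneg_left (mul_le_mul (prod_half_pow_boxExp_le K _)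
      (prod_half_pow_boxExp_le K' _) (Finset.prod_nonneg fun _ _ => by positivity)
      (by positivity)) (by positivity)
  calc Measure.pi (fun _ : Fin (d + 1) => μ) (prodSublevel u t ∩ prodSublevel v t')
      ≤ Measure.pi (fun _ : Fin (d + 1) => μ) (⋃ s ∈ Finset.univ, box s) := by
        refine measure_mono fun x hx => ?_
        obtain ⟨s, hs⟩ := exists_lt_boxExp K (t := fun j => u (x j)) (fun j => hu0 _) hx.1.1
          (hx.1.2.trans_le hK1)
        obtain ⟨s', hs'⟩ := exists_lt_boxExp K' (t := fun j => v (x j)) (fun j => hv0 _) hx.2.1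
          (hx.2.2.trans_le hK1')
        simp only [Set.mem_iUnion]
        exact ⟨(s, s'), Finset.mem_univ _, fun j _ => ⟨hs j, hs' j⟩⟩
    _ ≤ ∑ s : (Fin d → Fin (K + 1)) × (Fin d → Fin (K' + 1)),
          ENNReal.ofReal (C ^ (d + 1) * ((1 / 2) ^ K * (1 / 2) ^ K')) :=
        (measure_biUnion_finset_le _ _).trans (Finset.sum_le_sum fun s _ => hbox s)
    _ = ENNReal.ofReal ((((K : ℝ) + 1) ^ d * ((K' : ℝ) + 1) ^ d) *
          (C ^ (d + 1) * ((1 / 2) ^ K * (1 / 2) ^ K'))) := by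
        rw [Finset.sum_const, nsmul_eq_mul, ← ENNReal.ofReal_natCast,
          ← ENNReal.ofReal_mul (by positivity)]
        simp
    _ ≤ _ := by
        refine ENNReal.ofReal_le_ofReal ?_
        have : 0 ≤ C ^ (d + 1) := by positivity
        have hl := logWeight_nonneg d h0.le (h1.trans (logCutoff_lt_one d).le)
        calc _ = C ^ (d + 1) * ((((K : ℝ) + 1) ^ d * (1 / 2) ^ K) *
                (((K' : ℝ) + 1) ^ d * (1 / 2) ^ K')) := by ring
          _ ≤ C ^ (d + 1) * ((2 ^ (d + 1) * 3 ^ d * logWeight d t) *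
                (2 ^ (d + 1) * 3 ^ d * logWeight d t')) := by gcongr
          _ = _ := by ring

/-- Pack about `L^d` disjoint cells, each of measure at least `w^(d+1) 2^(-L-d)`, into the set. -/
lemma le_pi_prodSublevel {α : Type*} [MeasurableSpace α] (μ : Measure α) [SigmaFinite μ] {d : ℕ}
    {u : α → ℝ} (hum : Measurable u) (hu0 : ∀ x, 0 ≤ u x) {w : ℝ} (hw : 0 ≤ w)
    (hu : ∀ a b : ℝ, 0 ≤ a → b ≤ 1 → ENNReal.ofReal ((b - a) * w) ≤ μ {x | a ≤ u x ∧ u x < b})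
    {t : ℝ} (h0 : 0 < t) (h1 : t ≤ 1) :
    ENNReal.ofReal ((1 / 2) ^ (d + 1) * (1 / (d + 1)) ^ d * (w ^ (d + 1) * logWeight d t))
      ≤ Measure.pi (fun _ : Fin (d + 1) => μ) (prodSublevel u t) := by
  obtain ⟨L, hL1, hL2⟩ := exists_scale_lower d h0 h1
  -- Free exponents of at most `L / (d + 1)` have total at most `L`, so the subtraction in `boxExp`
  -- is not truncated, and there are still order `L^d` choices.
  set M := L / (d + 1) + 1 with hM
  let s' : (Fin d → Fin M) → Fin d → ℕ := fun s i => s i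
  have hs' : ∀ s, ∑ i, s' s i ≤ L := by
    intro s
    calc ∑ i, s' s i ≤ ∑ _i : Fin d, L / (d + 1) :=
          Finset.sum_le_sum fun i _ => Nat.lt_succ_iff.1 (s i).2
      _ = d * (L / (d + 1)) := by simp
      _ ≤ (d + 1) * (L / (d + 1)) := Nat.mul_le_mul_right _ (Nat.le_succ d)
      _ ≤ L := Nat.mul_div_le L (d + 1)
  -- The last `d` coordinates range over dyadic shells, which alone make the cells disjoint; the
  -- first may go down to 0.
  let lo : (Fin d → Fin M) → Fin (d + 1) → ℝ := fun s =>
    Fin.cons 0 fun i => (1 / 2 : ℝ) ^ (s' s i + 1)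
  let hi : (Fin d → Fin M) → Fin (d + 1) → ℝ := fun s j => (1 / 2) ^ boxExp L (s' s) j
  have hlo0 : ∀ s j, 0 ≤ lo s j := fun s j => by
    refine Fin.cases ?_ (fun i => ?_) j
    · simp [lo]
    · simp only [lo, Fin.cons_succ]; positivity
  have hhi1 : ∀ s j, hi s j ≤ 1 := fun s j => pow_le_one₀ (by norm_num) (by norm_num)
  let cell : (Fin d → Fin M) → Set (Fin (d + 1) → α) := fun s =>
    Set.univ.pi fun j => {x | lo s j ≤ u x ∧ u x < hi s j}
  have hmeas : ∀ s, MeasurableSet (cell s) := fun s =>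
    MeasurableSet.univ_pi fun j =>
      (measurableSet_le measurable_const hum).inter (measurableSet_lt hum measurable_const)
  have hdisj : Set.PairwiseDisjoint ((Finset.univ : Finset (Fin d → Fin M)) : Set _) cell := by
    intro s _ r _ hsr
    refine Set.disjoint_left.2 fun x hx hx' => hsr ?_
    funext i
    have h1 := hx i.succ trivial
    have h2 := hx' i.succ trivial
    simp only [lo, hi, boxExp, Fin.cons_succ, Set.mem_ofPred_eq] at h1 h2
    have h3 : s' s i < s' r i + 1 :=
      (pow_lt_pow_iff_right_of_lt_one₀ (by norm_num : (0 : ℝ) < 1 / 2) (by norm_num)).1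
        (h2.1.trans_lt h1.2)
    have h4 : s' r i < s' s i + 1 :=
      (pow_lt_pow_iff_right_of_lt_one₀ (by norm_num : (0 : ℝ) < 1 / 2) (by norm_num)).1
        (h1.1.trans_lt h2.2)
    apply Fin.ext
    simp only [s'] at h3 h4
    omega
  have hsub : (⋃ s ∈ Finset.univ, cell s) ⊆ prodSublevel u t := by
    intro x hx
    simp only [Set.mem_iUnion] at hx
    obtain ⟨s, -, hx⟩ := hx
    have hlt : ∀ j, u (x j) < hi s j := fun j => (hx j trivial).2
    refine ⟨fun j => (hlt j).trans_le (hhi1 s j), ?_⟩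
    have hprod : ∏ j, hi s j = (1 / 2 : ℝ) ^ L := by
      simp only [hi]
      rw [Finset.prod_pow_eq_pow_sum, sum_boxExp _ _ (hs' s)]
    refine lt_of_lt_of_le ?_ (hprod.le.trans hL1)
    rw [Fin.prod_univ_succ, Fin.prod_univ_succ]
    have hpos : 0 < ∏ i : Fin d, hi s i.succ :=
      Finset.prod_pos fun i _ => by simp only [hi]; positivity
    calc u (x 0) * ∏ i : Fin d, u (x i.succ) ≤ u (x 0) * ∏ i : Fin d, hi s i.succ :=
          mul_le_mul_of_nonneg_left
            (Finset.prod_le_prod (fun i _ => hu0 _) fun i _ => (hlt i.succ).le) (hu0 _)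
      _ < _ := mul_lt_mul_of_pos_right (hlt 0) hpos
  have hcell : ∀ s, ENNReal.ofReal (w ^ (d + 1) * (1 / 2) ^ (L + d))
      ≤ Measure.pi (fun _ : Fin (d + 1) => μ) (cell s) := by
    intro s
    rw [Measure.pi_pi]
    refine le_trans ?_ (Finset.prod_le_prod' fun j _ => hu _ _ (hlo0 s j) (hhi1 s j))
    have hdiff : ∀ i : Fin d, hi s i.succ - lo s i.succ = (1 / 2) ^ (s' s i + 1) := fun i => by
      simp only [hi, lo, boxExp, Fin.cons_succ, pow_succ]; ring
    have hdiff0 : hi s 0 - lo s 0 = (1 / 2) ^ (L - ∑ i, s' s i) := by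
      simp [hi, lo, boxExp]
    rw [← ENNReal.ofReal_prod_of_nonneg]
    · refine ENNReal.ofReal_le_ofReal (le_of_eq ?_)
      rw [Finset.prod_mul_distrib, Fin.prod_univ_succ, hdiff0, Finset.prod_congr rfl
        fun i _ => hdiff i, Finset.prod_pow_eq_pow_sum, Finset.sum_add_distrib, ← pow_add,
        Finset.prod_const, Finset.card_univ, Fintype.card_fin, mul_comm]
      congr 2
      have := hs' s
      simp only [Finset.sum_const, Finset.card_univ, Fintype.card_fin, smul_eq_mul, mul_one]
      omega
    · intro j _
      refine mul_nonneg ?_ hw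
      refine Fin.cases ?_ (fun i => ?_) j
      · rw [hdiff0]; positivity
      · rw [hdiff]; positivity
  have hcount : ((L : ℝ) + 1) / (d + 1) ≤ M := by
    rw [div_le_iff₀ (by positivity)]
    have : L + 1 ≤ M * (d + 1) := by
      have := Nat.lt_mul_div_succ L (Nat.succ_pos d)
      rw [Nat.succ_eq_add_one, mul_comm] at this
      exact this
    exact_mod_cast this
  calc _ ≤ ENNReal.ofReal ((M : ℝ) ^ d * (w ^ (d + 1) * (1 / 2) ^ (L + d))) := by
        refine ENNReal.ofReal_le_ofReal ?_
        have hw' : 0 ≤ w ^ (d + 1) := by positivity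
        calc _ ≤ (1 / 2 : ℝ) ^ (d + 1) * (1 / (d + 1)) ^ d *
              (w ^ (d + 1) * (2 * ((1 / 2) ^ L * ((L : ℝ) + 1) ^ d))) := by gcongr
          _ = (((L : ℝ) + 1) / (d + 1)) ^ d * (w ^ (d + 1) * (1 / 2) ^ (L + d)) := by
            rw [pow_add _ L d, pow_succ (1 / 2 : ℝ), div_eq_mul_one_div ((L : ℝ) + 1), mul_pow]; ring
          _ ≤ _ := by gcongr
    _ = ∑ _s : Fin d → Fin M, ENNReal.ofReal (w ^ (d + 1) * (1 / 2) ^ (L + d)) := by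
        rw [Finset.sum_const, nsmul_eq_mul, ← ENNReal.ofReal_natCast,
          ← ENNReal.ofReal_mul (by positivity)]
        simp
    _ ≤ ∑ s, Measure.pi (fun _ : Fin (d + 1) => μ) (cell s) :=
        Finset.sum_le_sum fun s _ => hcell s
    _ = Measure.pi (fun _ : Fin (d + 1) => μ) (⋃ s ∈ Finset.univ, cell s) :=
        (measure_biUnion_finset hdisj fun s _ => hmeas s).symm
    _ ≤ _ := measure_mono hsub

/-! ### The Kochen–Stone lemma -/

lemma integral_sum_indicator {Ω ι : Type*} [MeasurableSpace Ω] (P : Measure Ω)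
    [IsFiniteMeasure P] {A : ι → Set Ω} (hA : ∀ i, MeasurableSet (A i)) (s : Finset ι) :
    ∫ x, ∑ i ∈ s, (A i).indicator (fun _ => (1 : ℝ)) x ∂P = ∑ i ∈ s, P.real (A i) := by
  rw [integral_finsetSum _ fun i _ => (integrable_const (1 : ℝ)).indicator (hA i)]
  exact Finset.sum_congr rfl fun i _ => by simp [integral_indicator_const, hA i]

/-- The Kochen–Stone lemma: events of divergent total probability that are quasi-independent on
average occur infinitely often with positive probability. -/
lemma kochen_stone {Ω ι : Type*} [MeasurableSpace Ω] (P : Measure Ω) [IsProbabilityMeasure P]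
    {A : ι → Set Ω} (hA : ∀ i, MeasurableSet (A i)) (Q : ℕ → Finset ι) {C : ℝ} (hC : 0 < C)
    (hdiv : ∀ B : ℝ, ∃ N, B ≤ ∑ i ∈ Q N, P.real (A i))
    (hpair : ∀ N, 1 ≤ ∑ i ∈ Q N, P.real (A i) →
      ∑ i ∈ Q N, ∑ j ∈ Q N, P.real (A i ∩ A j) ≤ C * (∑ i ∈ Q N, P.real (A i)) ^ 2) :
    0 < P {x | {i | x ∈ A i}.Infinite} := by
  classical
  let Z : ℕ → Ω → ℝ := fun N x => ∑ i ∈ Q N, (A i).indicator (fun _ => (1 : ℝ)) x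
  have hZm : ∀ N, Measurable (Z N) := fun N =>
    Finset.measurable_fun_sum _ fun i _ => measurable_const.indicator (hA i)
  have hZsq : ∀ N x, Z N x ^ 2
      = ∑ p ∈ Q N ×ˢ Q N, (A p.1 ∩ A p.2).indicator (fun _ => (1 : ℝ)) x := fun N x => by
    simp only [Z]
    rw [sq, Finset.sum_mul_sum, Finset.sum_product]
    refine Finset.sum_congr rfl fun i _ => Finset.sum_congr rfl fun j _ => ?_
    by_cases hi : x ∈ A i <;> by_cases hj : x ∈ A j <;> simp [hi, hj]
  let B : ℕ → Set Ω := fun R => {x | ∃ N, (R : ℝ) ≤ Z N x}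
  have hBm : ∀ R, MeasurableSet (B R) := fun R => by
    have : B R = ⋃ N, {x | (R : ℝ) ≤ Z N x} := by ext; simp [B]
    rw [this]
    exact MeasurableSet.iUnion fun N => measurableSet_le measurable_const (hZm N)
  have hBanti : Antitone B := fun R R' h x hx => by
    obtain ⟨N, hN⟩ := hx
    exact ⟨N, le_trans (by exact_mod_cast h) hN⟩
  have hB : ∀ R, ENNReal.ofReal (1 / (4 * C)) ≤ P (B R) := by
    intro R
    obtain ⟨N, hN⟩ := hdiv (max 1 (2 * R))
    set e := ∑ i ∈ Q N, P.real (A i) with he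
    have he1 : 1 ≤ e := (le_max_left _ _).trans hN
    have heR : 2 * R ≤ e := (le_max_right _ _).trans hN
    have he0 : 0 < e := by linarith
    set G : Set Ω := {x | e / 2 ≤ Z N x} with hG
    have hGm : MeasurableSet G := measurableSet_le measurable_const (hZm N)
    -- A pointwise substitute for Paley–Zygmund: on `G` it is the inequality of arithmetic and
    -- geometric means. Integrating gives `e ≤ e/2 + e/4 + C e P(G)`.
    have hpt : ∀ x, Z N x ≤ e / 2 + 1 / (4 * C * e) * Z N x ^ 2
        + C * e * G.indicator (fun _ => (1 : ℝ)) x := by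
      intro x
      by_cases hx : x ∈ G
      · rw [Set.indicator_of_mem hx]
        have h : Z N x ≤ 1 / (4 * C * e) * Z N x ^ 2 + C * e * 1 := by
          have h2 : 0 ≤ 1 / (4 * C * e) * (Z N x - 2 * C * e) ^ 2 := by positivity
          have h3 : 1 / (4 * C * e) * (Z N x - 2 * C * e) ^ 2
              = 1 / (4 * C * e) * Z N x ^ 2 - Z N x + C * e := by field_simp; ring
          linarith
        linarith
      · rw [Set.indicator_of_notMem hx]
        have h1 : Z N x < e / 2 := not_le.1 hx
        have h2 : 0 ≤ 1 / (4 * C * e) * Z N x ^ 2 := by positivity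
        linarith
    have hZi : Integrable (Z N) P :=
      integrable_finsetSum _ fun i _ => (integrable_const (1 : ℝ)).indicator (hA i)
    have hZ2i : Integrable (fun x => Z N x ^ 2) P := by
      simp only [hZsq]
      exact integrable_finsetSum _ fun p _ =>
        (integrable_const (1 : ℝ)).indicator ((hA p.1).inter (hA p.2))
    have hGi : Integrable (G.indicator fun _ => (1 : ℝ)) P :=
      (integrable_const (1 : ℝ)).indicator hGm
    have hi1 : Integrable (fun x => e / 2 + 1 / (4 * C * e) * Z N x ^ 2) P :=
      (integrable_const _).add (hZ2i.const_mul _)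
    have hint := integral_mono hZi (hi1.add (hGi.const_mul (C * e))) hpt
    have hZ1 : ∫ x, Z N x ∂P = e := integral_sum_indicator P hA (Q N)
    have hZ2 : ∫ x, Z N x ^ 2 ∂P = ∑ i ∈ Q N, ∑ j ∈ Q N, P.real (A i ∩ A j) := by
      simp only [hZsq]
      rw [integral_sum_indicator P (A := fun p : ι × ι => A p.1 ∩ A p.2)
        (fun p => (hA p.1).inter (hA p.2)), Finset.sum_product]
    have hG1 : ∫ x, G.indicator (fun _ => (1 : ℝ)) x ∂P = P.real G := by
      simp [integral_indicator_const, hGm]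
    simp only [Pi.add_apply] at hint
    rw [integral_add hi1 (hGi.const_mul (C * e)),
      integral_add (integrable_const (e / 2)) (hZ2i.const_mul _), integral_const_mul,
      integral_const_mul, hZ1, hZ2, hG1] at hint
    simp only [integral_const, probReal_univ, smul_eq_mul, one_mul] at hint
    have hp := hpair N he1
    have hp' : 1 / (4 * C * e) * ∑ i ∈ Q N, ∑ j ∈ Q N, P.real (A i ∩ A j) ≤ e / 4 := by
      calc _ ≤ 1 / (4 * C * e) * (C * e ^ 2) := by gcongr
        _ = e / 4 := by field_simp
    have hfin : 1 / (4 * C) ≤ P.real G := by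
      rw [div_le_iff₀ (by positivity)]
      have : e / 4 ≤ C * e * P.real G := by linarith
      have h4 : e * 1 ≤ e * (P.real G * (4 * C)) := by linarith
      exact le_of_mul_le_mul_left h4 he0
    calc ENNReal.ofReal (1 / (4 * C)) ≤ ENNReal.ofReal (P.real G) := ENNReal.ofReal_le_ofReal hfin
      _ = P G := ofReal_measureReal
      _ ≤ P (B R) := measure_mono fun x hx => ⟨N, by
          have : e / 2 ≤ Z N x := hx
          linarith⟩
  have hlim := tendsto_measure_iInter_atTop (μ := P) (s := B)
    (fun R => (hBm R).nullMeasurableSet) hBanti ⟨0, measure_ne_top _ _⟩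
  have hle : ENNReal.ofReal (1 / (4 * C)) ≤ P (⋂ R, B R) := ge_of_tendsto' hlim hB
  refine lt_of_lt_of_le (ENNReal.ofReal_pos.2 (by positivity)) (hle.trans (measure_mono ?_))
  intro x hx hfin
  obtain ⟨R, hR⟩ := exists_nat_gt ((hfin.toFinset.card : ℝ))
  obtain ⟨N, hN⟩ := Set.mem_iInter.1 hx R
  have : Z N x ≤ hfin.toFinset.card := by
    calc Z N x = ∑ i ∈ (Q N).filter (fun i => x ∈ A i), (1 : ℝ) := by
          rw [Finset.sum_filter]; rfl
      _ = (((Q N).filter fun i => x ∈ A i).card : ℝ) := by simp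
      _ ≤ _ := by
          refine Nat.cast_le.2 (Finset.card_le_card fun i hi => ?_)
          rw [Set.Finite.mem_toFinset]
          exact (Finset.mem_filter.1 hi).2
  linarith

/-! ### A zero-one law from the doubling map -/

/-- The uniform measure on `([0, 1]ⁿ)ᵐ`. -/
noncomputable def matrixMeasure (m n : ℕ) : Measure (Fin m → Fin n → ℝ) :=
  Measure.pi fun _ => cubeMeasure n

instance (m n : ℕ) : IsProbabilityMeasure (matrixMeasure m n) := by
  unfold matrixMeasure; infer_instance

/-- The matrices whose columns `xⱼ` satisfy `∏ⱼ ‖qᵢ xⱼ‖ < φᵢ` for infinitely many `i`. -/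
def multLimsup {m n : ℕ} {ι : Type*} (q : ι → Fin n → ℤ) (φ : ι → ℝ) :
    Set (Fin m → Fin n → ℝ) :=
  {x | {i | ∏ j, distNearestInt (intForm (q i) (x j)) < φ i}.Infinite}

lemma distNearestInt_intForm {n : ℕ} (q : Fin n → ℤ) (x : Fin n → ℝ) :
    distNearestInt (intForm q x) = ‖torusForm q fun i => (x i : UnitAddCircle)‖ := by
  rw [torusForm_coe, UnitAddCircle.norm_eq]; rfl

lemma measurableSet_infinite {Ω ι : Type*} [MeasurableSpace Ω] [Countable ι] {E : ι → Set Ω}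
    (hE : ∀ i, MeasurableSet (E i)) : MeasurableSet {x | {i | x ∈ E i}.Infinite} := by
  have : {x | {i | x ∈ E i}.Infinite} = ⋂ s : Finset ι, ⋃ i : {i // i ∉ s}, E i := by
    ext x
    simp only [Set.mem_ofPred_eq, Set.mem_iInter, Set.mem_iUnion]
    constructor
    · intro h s
      obtain ⟨i, hi, his⟩ := h.exists_notMem_finset s
      exact ⟨⟨i, his⟩, hi⟩
    · intro h hfin
      obtain ⟨⟨i, hi⟩, hx⟩ := h hfin.toFinset
      exact hi (hfin.mem_toFinset.2 hx)
  rw [this]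
  exact MeasurableSet.iInter fun s => MeasurableSet.iUnion fun i => hE i

lemma dense_dyadic_torus (m n : ℕ) :
    Dense (⋃ k : ℕ, (nsmulAddMonoidHom (α := Fin m → Fin n → UnitAddCircle) 2)^[k] ⁻¹' 0) := by
  intro x
  let t : Fin m → Fin n → ℝ := fun j i => circleRep (x j i)
  have ht : ∀ j i, ((t j i : ℝ) : UnitAddCircle) = x j i := fun j i =>
    (AddCircle.equivIco 1 0).symm_apply_apply (x j i)
  have ht0 : ∀ j i, 0 ≤ t j i := fun j i => (AddCircle.equivIco 1 0 (x j i)).2.1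
  let y : ℕ → Fin m → Fin n → UnitAddCircle := fun k j i =>
    (((⌊t j i * 2 ^ k⌋₊ : ℝ) / 2 ^ k : ℝ) : UnitAddCircle)
  have hy : Filter.Tendsto y Filter.atTop (nhds x) := by
    rw [tendsto_pi_nhds]; intro j
    rw [tendsto_pi_nhds]; intro i
    rw [← ht j i]
    refine ((AddCircle.continuous_mk' 1).tendsto _).comp ?_
    exact (tendsto_nat_floor_mul_div_atTop (ht0 j i)).comp
      (tendsto_pow_atTop_atTop_of_one_lt (by norm_num : (1 : ℝ) < 2))
  refine mem_closure_of_tendsto hy (Filter.Eventually.of_forall fun k => ?_)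
  have hiter : ∀ (k : ℕ) (z : Fin m → Fin n → UnitAddCircle),
      (nsmulAddMonoidHom (α := Fin m → Fin n → UnitAddCircle) 2)^[k] z = 2 ^ k • z := by
    intro k
    induction k with
    | zero => intro z; simp
    | succ k ih =>
      intro z
      rw [Function.iterate_succ_apply, ih, nsmulAddMonoidHom_apply, smul_smul, ← pow_succ]
  refine Set.mem_iUnion.2 ⟨k, ?_⟩
  rw [Set.mem_preimage, hiter, Set.mem_zero]
  funext j i
  change 2 ^ k • y k j i = 0
  have h2 : ((2 : ℝ) ^ k) ≠ 0 := by positivity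
  have : (2 ^ k) • ((⌊t j i * 2 ^ k⌋₊ : ℝ) / 2 ^ k : ℝ) = (⌊t j i * 2 ^ k⌋₊ : ℤ) • (1 : ℝ) := by
    rw [nsmul_eq_mul, zsmul_eq_mul]; push_cast; field_simp
  change (2 ^ k) • (((⌊t j i * 2 ^ k⌋₊ : ℝ) / 2 ^ k : ℝ) : UnitAddCircle) = 0
  rw [← AddCircle.coe_nsmul, this, AddCircle.coe_zsmul, AddCircle.coe_period, smul_zero]

/-- Doubling is surjective, and the kernels of its iterates, the dyadic points, have dense union;
this forces ergodicity. -/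
lemma ergodic_double_torus (m n : ℕ) :
    Ergodic (nsmulAddMonoidHom (α := Fin m → Fin n → UnitAddCircle) 2) volume := by
  have : (volume : Measure (Fin m → Fin n → UnitAddCircle)).IsAddHaarMeasure :=
    Measure.pi.isAddHaarMeasure fun _ => volume
  refine AddMonoidHom.ergodic_of_dense_iUnion_preimage_zero _ (dense_dyadic_torus m n)
    (continuous_nsmul 2) fun x => ?_
  refine ⟨fun j i => ((circleRep (x j i) / 2 : ℝ) : UnitAddCircle), ?_⟩
  funext j i
  change 2 • ((circleRep (x j i) / 2 : ℝ) : UnitAddCircle) = x j i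
  rw [← AddCircle.coe_nsmul, nsmul_eq_mul]
  push_cast
  rw [mul_div_cancel₀ _ two_ne_zero]
  exact (AddCircle.equivIco 1 0).symm_apply_apply (x j i)

/-- A zero-one law: if `multLimsup q φ` is not null, then almost every matrix lies in
`multLimsup q (K φ)` for some `K`. -/
lemma iUnion_multLimsup_eq_one {m n : ℕ} {ι : Type*} [Countable ι] (q : ι → Fin n → ℤ)
    (φ : ι → ℝ) (h : 0 < matrixMeasure m n (multLimsup q φ)) :
    matrixMeasure m n (⋃ K : ℕ, multLimsup q fun i => K * φ i) = 1 := by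
  let E : ℕ → ι → Set (Fin m → Fin n → UnitAddCircle) := fun K i =>
    {x | ∏ j, ‖torusForm (q i) (x j)‖ < K * φ i}
  let T : ℕ → Set (Fin m → Fin n → UnitAddCircle) := fun K => {x | {i | x ∈ E K i}.Infinite}
  let π : (Fin m → Fin n → ℝ) → Fin m → Fin n → UnitAddCircle := fun x j i => x j i
  have hπ : MeasurePreserving π (matrixMeasure m n) volume :=
    measurePreserving_pi (fun _ => cubeMeasure n) (fun _ => volume)
      (f := fun _ (x : Fin n → ℝ) i => (x i : UnitAddCircle)) fun _ => measurePreserving_coe_torus n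
  have hEm : ∀ K i, MeasurableSet (E K i) := fun K i => by
    have hc : Continuous fun x : Fin m → Fin n → UnitAddCircle =>
        ∏ j, ‖torusForm (q i) (x j)‖ :=
      continuous_finsetProd _ fun j _ =>
        ((continuous_torusForm (q i)).comp (continuous_apply j)).norm
    exact measurableSet_lt hc.measurable measurable_const
  have hTm : ∀ K, MeasurableSet (T K) := fun K => measurableSet_infinite (hEm K)
  have hpre : ∀ K, π ⁻¹' T K = multLimsup q fun i => K * φ i := fun K => by
    ext x
    simp only [multLimsup, T, E, π, Set.mem_preimage, Set.mem_ofPred_eq, distNearestInt_intForm]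
  set U := ⋃ K, T K with hU
  have hUm : MeasurableSet U := MeasurableSet.iUnion hTm
  -- Doubling multiplies the product by at most `2^m`. The union over `K` absorbs this, so `U` is
  -- forward invariant although a single `T K` need not be.
  have hsub : U ⊆ nsmulAddMonoidHom (α := Fin m → Fin n → UnitAddCircle) 2 ⁻¹' U := by
    intro x hx
    obtain ⟨K, hK⟩ := Set.mem_iUnion.1 hx
    refine Set.mem_iUnion.2 ⟨2 ^ m * K, ?_⟩
    refine Set.Infinite.mono (fun i hi => ?_) hK
    simp only [E, Set.mem_ofPred_eq] at hi ⊢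
    calc ∏ j, ‖torusForm (q i) ((2 • x) j)‖ ≤ ∏ j : Fin m, 2 * ‖torusForm (q i) (x j)‖ := by
          refine Finset.prod_le_prod (fun _ _ => norm_nonneg _) fun j _ => ?_
          rw [Pi.smul_apply, map_nsmul]
          simpa using norm_nsmul_le (n := 2) (a := torusForm (q i) (x j))
      _ = 2 ^ m * ∏ j : Fin m, ‖torusForm (q i) (x j)‖ := by
          rw [Finset.prod_mul_distrib]; simp
      _ < 2 ^ m * (K * φ i) := by gcongr
      _ = _ := by push_cast; ring
  have hpos : 0 < volume U := by
    have h1 : multLimsup q φ = π ⁻¹' T 1 := by rw [hpre]; simp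
    rw [h1, hπ.measure_preimage (hTm 1).nullMeasurableSet] at h
    exact h.trans_le (measure_mono (Set.subset_iUnion T 1))
  have hfull : volume U = 1 := by
    rcases (ergodic_double_torus m n).ae_empty_or_univ_of_ae_le_preimage hUm.nullMeasurableSet
      (Filter.Eventually.of_forall hsub) with h0 | h0
    · rw [measure_congr h0, measure_empty] at hpos
      exact absurd hpos (lt_irrefl _)
    · rw [measure_congr h0, measure_univ]
  simp only [← hpre]
  rw [← Set.preimage_iUnion, hπ.measure_preimage hUm.nullMeasurableSet, hfull]

/-! ### Primitive parts and pairwise quasi-independence -/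

/-- The integer vector `(σᵢ kᵢ)`. -/
def scaleVec {n : ℕ} (σ : Fin n → ℤ) (k : Fin n → ℕ) : Fin n → ℤ := fun i => σ i * k i

/-- The vector `k` divided by the greatest common divisor of its coordinates. -/
def primVec {n : ℕ} (k : Fin n → ℕ) : Fin n → ℕ := fun i => k i / vecGcd k

lemma vecGcd_mul_primVec {n : ℕ} (k : Fin n → ℕ) (i : Fin n) : vecGcd k * primVec k i = k i :=
  Nat.mul_div_cancel' (vecGcd_dvd k i)

lemma vecGcd_primVec {n : ℕ} {k : Fin n → ℕ} {l : Fin n} (h : 1 ≤ k l) :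
    Finset.univ.gcd (primVec k) = 1 :=
  Finset.gcd_div_eq_one (Finset.mem_univ l) (by omega)

/-- If all minors vanished, taking the gcd over `j` in `kᵢ k'ⱼ = kⱼ k'ᵢ` would make the two
primitive vectors equal. -/
lemma exists_minor_ne_zero {n : ℕ} {k k' : Fin n → ℕ} {l : Fin n} (h : 1 ≤ k l) (h' : 1 ≤ k' l)
    (hne : primVec k ≠ primVec k') :
    ∃ i j, primVec k i * primVec k' j ≠ primVec k j * primVec k' i := by
  by_contra hc
  push Not at hc
  refine hne (funext fun i => ?_)
  have h1 : Finset.univ.gcd (fun j => primVec k i * primVec k' j) = primVec k i := by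
    rw [Finset.gcd_mul_left, vecGcd_primVec h', mul_one]; simp
  have h2 : Finset.univ.gcd (fun j => primVec k j * primVec k' i) = primVec k' i := by
    rw [Finset.gcd_mul_right, vecGcd_primVec h, one_mul]; simp
  rw [← h1, ← h2]
  exact congrArg _ (funext fun j => hc i j)

/-- The coprime fractional part attached to the linear form with coefficients `σᵢ kᵢ`. -/
noncomputable def formFract {n : ℕ} (σ : Fin n → ℤ) (k : Fin n → ℕ) (x : Fin n → ℝ) : ℝ :=
  coprimeFract (vecGcd k) (Int.fract (intForm (scaleVec σ (primVec k)) x))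

lemma measurable_intForm {n : ℕ} (q : Fin n → ℤ) : Measurable (intForm q) := by
  unfold intForm; fun_prop

lemma measurable_formFract {n : ℕ} (σ : Fin n → ℤ) (k : Fin n → ℕ) :
    Measurable (formFract σ k) :=
  (measurable_coprimeFract _).comp (measurable_intForm _).fract

lemma distNearestInt_le_fract (t : ℝ) : distNearestInt t ≤ Int.fract t := by
  rw [distNearestInt, abs_sub_round_eq_min]; exact min_le_left _ _

lemma intForm_scaleVec {n : ℕ} (σ : Fin n → ℤ) (k : Fin n → ℕ) (x : Fin n → ℝ) :
    intForm (scaleVec σ k) x = vecGcd k * intForm (scaleVec σ (primVec k)) x := by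
  simp only [intForm, scaleVec, Finset.mul_sum]
  refine Finset.sum_congr rfl fun i _ => ?_
  rw [← vecGcd_mul_primVec k i]
  push_cast
  ring

/-- Hence the restricted events, for which overlaps are controlled, lie inside the wanted ones. -/
lemma distNearestInt_le_formFract {n : ℕ} (σ : Fin n → ℤ) (k : Fin n → ℕ) (x : Fin n → ℝ) :
    distNearestInt (intForm (scaleVec σ k) x) ≤ formFract σ k x := by
  refine (distNearestInt_le_fract _).trans (le_trans (le_of_eq ?_) (fract_le_coprimeFract _ _))
  rw [intForm_scaleVec, Int.fract_eq_fract]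
  set t := intForm (scaleVec σ (primVec k)) x
  exact ⟨vecGcd k * ⌊t⌋, by rw [Int.fract]; push_cast; ring⟩

lemma scaleVec_primVec_ne_zero {n : ℕ} {σ : Fin n → ℤ} (hσ : ∀ i, σ i ≠ 0) {k : Fin n → ℕ}
    {l : Fin n} (h : 1 ≤ k l) : scaleVec σ (primVec k) l ≠ 0 := by
  refine mul_ne_zero (hσ l) ?_
  have h1 := vecGcd_mul_primVec k l
  have : primVec k l ≠ 0 := fun h0 => by rw [h0, mul_zero] at h1; omega
  exact_mod_cast this

lemma le_cubeMeasure_formFract {n : ℕ} {σ : Fin n → ℤ} (hσ : ∀ i, σ i ≠ 0) {k : Fin n → ℕ}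
    {l : Fin n} (h : 1 ≤ k l) (a b : ℝ) (ha : 0 ≤ a) (hb : b ≤ 1) :
    ENNReal.ofReal ((b - a) * coprimeRatio (vecGcd k))
      ≤ cubeMeasure n {x | a ≤ formFract σ k x ∧ formFract σ k x < b} := by
  have hmp := measurePreserving_fract_intForm (scaleVec_primVec_ne_zero hσ h)
  have hm : MeasurableSet {y | a ≤ coprimeFract (vecGcd k) y ∧ coprimeFract (vecGcd k) y < b} :=
    (measurableSet_le measurable_const (measurable_coprimeFract _)).inter
      (measurableSet_lt (measurable_coprimeFract _) measurable_const)
  refine (le_unitMeasure_coprimeFract (vecGcd_pos h) ha hb).trans (le_of_eq ?_)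
  exact (hmp.measure_preimage hm.nullMeasurableSet).symm

/-- Equal primitive parts force different gcds, and the bound for distinct denominators applies.
Different primitive parts give independent forms. -/
lemma cubeMeasure_formFract_pair_le {n : ℕ} {σ : Fin n → ℤ} (hσ : ∀ i, σ i ≠ 0)
    {k k' : Fin n → ℕ} {l : Fin n} (h : 1 ≤ k l) (h' : 1 ≤ k' l) (hne : k ≠ k') (a b : ℕ) :
    cubeMeasure n {x | formFract σ k x < (1 / 2) ^ a ∧ formFract σ k' x < (1 / 2) ^ b}
      ≤ ENNReal.ofReal (2 * (1 / 2) ^ a * (1 / 2) ^ b) := by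
  have hlt : ∀ g (δ : ℝ), MeasurableSet {y | coprimeFract g y < δ} := fun g δ =>
    measurableSet_lt (measurable_coprimeFract g) measurable_const
  have hle1 : ∀ a : ℕ, (1 / 2 : ℝ) ^ a ≤ 1 := fun a => pow_le_one₀ (by norm_num) (by norm_num)
  by_cases hp : primVec k = primVec k'
  · have hg : vecGcd k ≠ vecGcd k' := fun hg => hne (funext fun i => by
      rw [← vecGcd_mul_primVec k i, ← vecGcd_mul_primVec k' i, hg, hp])
    have hmp := measurePreserving_fract_intForm (scaleVec_primVec_ne_zero hσ h)
    refine le_trans (le_of_eq ?_) (unitMeasure_coprimeFract_pair_le (vecGcd_pos h) (vecGcd_pos h') hg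
      (by positivity) (hle1 a) (by positivity) (hle1 b))
    simp only [formFract, ← hp]
    exact hmp.measure_preimage ((hlt _ _).inter (hlt _ _)).nullMeasurableSet
  · obtain ⟨i, j, hij⟩ := exists_minor_ne_zero h h' hp
    have hdet : scaleVec σ (primVec k) i * scaleVec σ (primVec k') j
        - scaleVec σ (primVec k) j * scaleVec σ (primVec k') i ≠ 0 := by
      have h1 : (primVec k i : ℤ) * primVec k' j - primVec k j * primVec k' i ≠ 0 := by
        rw [sub_ne_zero]; exact_mod_cast hij
      have h2 := mul_ne_zero (mul_ne_zero (hσ i) (hσ j)) h1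
      intro h0
      apply h2
      rw [← h0]
      simp only [scaleVec]
      ring
    have hmp := measurePreserving_fract_intForm_prod hdet
    have hpre := hmp.measure_preimage
      ((hlt (vecGcd k) ((1 / 2) ^ a)).prod (hlt (vecGcd k') ((1 / 2) ^ b))).nullMeasurableSet
    rw [Measure.prod_prod] at hpre
    calc _ = unitMeasure {y | coprimeFract (vecGcd k) y < (1 / 2) ^ a}
          * unitMeasure {y | coprimeFract (vecGcd k') y < (1 / 2) ^ b} := hpre
      _ ≤ ENNReal.ofReal ((1 / 2) ^ a) * ENNReal.ofReal ((1 / 2) ^ b) :=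
        mul_le_mul' (unitMeasure_coprimeFract_lt_le (vecGcd_pos h) (hle1 a))
          (unitMeasure_coprimeFract_lt_le (vecGcd_pos h') (hle1 b))
      _ ≤ _ := by
        rw [← ENNReal.ofReal_mul (by positivity)]
        refine ENNReal.ofReal_le_ofReal ?_
        have : (0 : ℝ) ≤ (1 / 2) ^ a * (1 / 2) ^ b := by positivity
        linarith

/-! ### Positive and then full measure in one orthant -/

lemma prodSublevel_zero {α : Type*} {m : ℕ} {u : α → ℝ} (hu : ∀ x, 0 ≤ u x) :
    prodSublevel (m := m) u 0 = ∅ := by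
  refine Set.eq_empty_of_forall_notMem fun x hx => ?_
  exact absurd hx.2 (not_lt.2 (Finset.prod_nonneg fun _ _ => hu _))

lemma multLimsup_pos {n d : ℕ} {σ : Fin n → ℤ} (hσ : ∀ i, σ i ≠ 0) (l : Fin n)
    {φ : (Fin n → ℕ) → ℝ} (hφ : Antitone φ) (h0 : ∀ k, 0 ≤ φ k) (h1 : ∀ k, φ k ≤ logCutoff d)
    (hdiv : ∀ B : ℝ, ∃ N, B ≤ ∑ k ∈ posBox l N, logWeight d (φ k)) :
    0 < matrixMeasure (d + 1) n (multLimsup (scaleVec σ) φ) := by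
  classical
  set P := matrixMeasure (d + 1) n with hP
  set F : (Fin n → ℕ) → ℝ := fun k => logWeight d (φ k) with hF
  have hle1 : ∀ k, φ k ≤ 1 := fun k => (h1 k).trans (logCutoff_lt_one d).le
  have hF0 : ∀ k, 0 ≤ F k := fun k => logWeight_nonneg d (h0 k) (hle1 k)
  have hFa : Antitone F := fun k k' h => logWeight_mono d (h0 k') (hφ h) (h1 k)
  have hu0 : ∀ k x, 0 ≤ formFract σ k x := fun k x => coprimeFract_nonneg _ _
  let A : (Fin n → ℕ) → Set (Fin (d + 1) → Fin n → ℝ) := fun k =>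
    prodSublevel (formFract σ k) (φ k)
  have hA : ∀ k, MeasurableSet (A k) := fun k =>
    measurableSet_prodSublevel (measurable_formFract σ k) _
  set c : ℝ := (1 / 2) ^ (d + 1) * (1 / (d + 1)) ^ d with hc
  have hc0 : 0 < c := by positivity
  set D : ℝ := 2 ^ (d + 1) * (2 ^ (d + 1) * 3 ^ d) ^ 2 with hD
  have hD0 : 0 < D := by positivity
  have hlow : ∀ k, 1 ≤ k l → c * (coprimeRatio (vecGcd k) ^ (d + 1) * F k) ≤ P.real (A k) := by
    intro k hk
    rcases (h0 k).eq_or_lt with hz | hz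
    · have : F k = 0 := by simp only [hF, ← hz, logWeight_zero]
      rw [this, mul_zero, mul_zero]
      exact measureReal_nonneg
    · rw [Measure.real, ← ENNReal.ofReal_le_iff_le_toReal (measure_ne_top _ _)]
      exact le_pi_prodSublevel (cubeMeasure n) (measurable_formFract σ k) (hu0 k)
        (coprimeRatio_nonneg _) (le_cubeMeasure_formFract hσ hk) hz (hle1 k)
  have hupp : ∀ k k', 1 ≤ k l → 1 ≤ k' l → k ≠ k' → P.real (A k ∩ A k') ≤ D * (F k * F k') := by
    intro k k' hk hk' hne
    have hR : 0 ≤ D * (F k * F k') := mul_nonneg hD0.le (mul_nonneg (hF0 k) (hF0 k'))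
    rcases (h0 k).eq_or_lt with hz | hz
    · have : A k = ∅ := by simp only [A, ← hz]; exact prodSublevel_zero (hu0 k)
      rw [this, Set.empty_inter, measureReal_empty]; exact hR
    rcases (h0 k').eq_or_lt with hz' | hz'
    · have : A k' = ∅ := by simp only [A, ← hz']; exact prodSublevel_zero (hu0 k')
      rw [this, Set.inter_empty, measureReal_empty]; exact hR
    refine ENNReal.toReal_le_of_le_ofReal hR ?_
    exact pi_prodSublevel_inter_le (cubeMeasure n) (hu0 k) (hu0 k') zero_le_two
      (cubeMeasure_formFract_pair_le hσ hk hk' hne) hz (h1 k) hz' (h1 k')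
  set c' : ℝ := c * (1 / 8) ^ (d + 1) with hc'
  have hc'0 : 0 < c' := by positivity
  have hsum : ∀ N, c' * ∑ k ∈ posBox l N, F k ≤ ∑ k ∈ posBox l N, P.real (A k) := by
    intro N
    calc c' * ∑ k ∈ posBox l N, F k = c * ((1 / 8) ^ (d + 1) * ∑ k ∈ posBox l N, F k) := by
          rw [hc', mul_assoc]
      _ ≤ c * ∑ k ∈ posBox l N, coprimeRatio (vecGcd k) ^ (d + 1) * F k :=
          mul_le_mul_of_nonneg_left (sum_le_sum_coprimeRatio_pow l hFa hF0 N d) hc0.le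
      _ ≤ _ := by
          rw [Finset.mul_sum]
          exact Finset.sum_le_sum fun k hk => hlow k (mem_posBox.1 hk).2
  -- The `1` accounts for the diagonal, where `e ≤ e ^ 2` because `e ≥ 1`; the rest comes from `D *
  -- S ^ 2` with `S ≤ e / c'`.
  have hks := kochen_stone P hA (posBox l) (C := 1 + D / c' ^ 2) (by positivity) (fun B => ?_)
    fun N hN => ?_
  · refine hks.trans_le (measure_mono fun x hx => ?_)
    refine Set.Infinite.mono (fun k hk => ?_) hx
    have hk' : x ∈ prodSublevel (formFract σ k) (φ k) := hk
    exact (Finset.prod_le_prod (fun _ _ => abs_nonneg _)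
      fun j _ => distNearestInt_le_formFract σ k (x j)).trans_lt hk'.2
  · obtain ⟨N, hN⟩ := hdiv (B / c')
    refine ⟨N, le_trans ?_ (hsum N)⟩
    rwa [div_le_iff₀' hc'0] at hN
  · set e := ∑ k ∈ posBox l N, P.real (A k) with he
    set S := ∑ k ∈ posBox l N, F k with hS
    have hS0 : 0 ≤ S := Finset.sum_nonneg fun k _ => hF0 k
    have hSe : S ≤ e / c' := by rw [le_div_iff₀' hc'0]; exact hsum N
    calc ∑ k ∈ posBox l N, ∑ k' ∈ posBox l N, P.real (A k ∩ A k')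
        ≤ ∑ k ∈ posBox l N, ∑ k' ∈ posBox l N,
            ((if k = k' then P.real (A k) else 0) + D * (F k * F k')) := by
          refine Finset.sum_le_sum fun k hk => Finset.sum_le_sum fun k' hk' => ?_
          split_ifs with heq
          · subst heq
            rw [Set.inter_self]
            exact le_add_of_nonneg_right (mul_nonneg hD0.le (mul_nonneg (hF0 k) (hF0 k)))
          · rw [zero_add]
            exact hupp k k' (mem_posBox.1 hk).2 (mem_posBox.1 hk').2 heq
      _ = e + D * S ^ 2 := by
          simp only [Finset.sum_add_distrib, Finset.sum_ite_eq, ← Finset.mul_sum]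
          rw [← Finset.sum_mul, sq]
          congr 1
          exact Finset.sum_congr rfl fun k hk => if_pos hk
      _ ≤ e ^ 2 + D * (e / c') ^ 2 := by
          gcongr
          nlinarith
      _ = _ := by ring

lemma sup_le_of_mem_posBox {n : ℕ} {l : Fin n} (N : ℕ) (k : Fin n → ℕ) (hk : k ∈ posBox l N) :
    Finset.univ.sup k ≤ N := Finset.sup_le fun i _ => (mem_posBox.1 hk).1 i

lemma finite_sup_lt {n : ℕ} (N : ℕ) : {k : Fin n → ℕ | Finset.univ.sup k < N}.Finite := by
  refine (Fintype.piFinset fun _ : Fin n => Finset.range N).finite_toSet.subset fun k hk => ?_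
  have hk' : Finset.univ.sup k < N := hk
  simp only [Finset.mem_coe, Fintype.mem_piFinset, Finset.mem_range]
  exact fun i => (Finset.le_sup (Finset.mem_univ i)).trans_lt hk'

lemma multLimsup_eq_one {n d : ℕ} {σ : Fin n → ℤ} (hσ : ∀ i, σ i ≠ 0) (l : Fin n)
    {φ : (Fin n → ℕ) → ℝ} (hφ : Antitone φ) (h0 : ∀ k, 0 ≤ φ k) (h1 : ∀ k, φ k ≤ logCutoff d)
    (hdiv : ∀ B : ℝ, ∃ N, B ≤ ∑ k ∈ posBox l N, logWeight d (φ k)) :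
    matrixMeasure (d + 1) n (multLimsup (scaleVec σ) φ) = 1 := by
  have hle1 : ∀ k, φ k ≤ 1 := fun k => (h1 k).trans (logCutoff_lt_one d).le
  set F : (Fin n → ℕ) → ℝ := fun k => logWeight d (φ k) with hF
  have hF0 : ∀ k, 0 ≤ F k := fun k => logWeight_nonneg d (h0 k) (hle1 k)
  set G : ℕ → ℝ := fun N => 1 + ∑ k ∈ posBox l N, F k with hG
  have hG1 : ∀ N, 1 ≤ G N := fun N =>
    le_add_of_nonneg_right (Finset.sum_nonneg fun k _ => hF0 k)
  have hGm : Monotone G := fun M N h => add_le_add_right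
    (Finset.sum_le_sum_of_subset_of_nonneg (posBox_mono l h) fun _ _ _ => hF0 _) 1
  let rank : (Fin n → ℕ) → ℕ := fun k => Finset.univ.sup k
  have hrank : Monotone rank := fun k k' h => Finset.sup_mono_fun fun i _ => h i
  set φ' : (Fin n → ℕ) → ℝ := fun k => (G (rank k))⁻¹ * φ k with hφ'
  have hGpos : ∀ N, 0 < G N := fun N => one_pos.trans_le (hG1 N)
  have hinv1 : ∀ N, (G N)⁻¹ ≤ 1 := fun N => inv_le_one_of_one_le₀ (hG1 N)
  have hφ'a : Antitone φ' := fun k k' h =>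
    mul_le_mul (inv_anti₀ (hGpos _) (hGm (hrank h))) (hφ h) (h0 _) (inv_nonneg.2 (hGpos _).le)
  have hφ'0 : ∀ k, 0 ≤ φ' k := fun k => mul_nonneg (inv_nonneg.2 (hGpos _).le) (h0 k)
  have hφ'1 : ∀ k, φ' k ≤ logCutoff d := fun k =>
    (mul_le_of_le_one_left (h0 k) (hinv1 _)).trans (h1 k)
  have hpos := multLimsup_pos hσ l hφ'a hφ'0 hφ'1 fun B => by
    obtain ⟨N, hN⟩ := abel_dini (posBox_mono l) (rank := rank) sup_le_of_mem_posBox hF0 hdiv B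
    refine ⟨N, hN.trans (Finset.sum_le_sum fun k _ => ?_)⟩
    exact mul_logWeight_le d (inv_pos.2 (hGpos _)) (hinv1 _) (h0 k) (hle1 k)
  have hfull := iUnion_multLimsup_eq_one (scaleVec σ) φ' hpos
  refine le_antisymm prob_le_one (hfull.ge.trans (measure_mono ?_))
  refine Set.iUnion_subset fun K x hx => ?_
  obtain ⟨N, hN⟩ := hdiv K
  have hinf := Set.Infinite.sdiff hx (finite_sup_lt (n := n) N)
  refine hinf.mono fun k hk => ?_
  have hk1 : ∏ j, distNearestInt (intForm (scaleVec σ k) (x j)) < K * φ' k := hk.1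
  have hk2 : N ≤ rank k := not_lt.1 hk.2
  refine hk1.trans_le ?_
  have hKG : (K : ℝ) ≤ G (rank k) := by
    have h2 : G N ≤ G (rank k) := hGm hk2
    have h3 : G N = 1 + ∑ k ∈ posBox l N, F k := rfl
    linarith
  calc (K : ℝ) * φ' k = (K * (G (rank k))⁻¹) * φ k := by rw [hφ', mul_assoc]
    _ ≤ 1 * φ k := by
      refine mul_le_mul_of_nonneg_right ?_ (h0 k)
      rw [← div_eq_mul_inv]
      exact div_le_one_of_le₀ hKG (hGpos _).le
    _ = φ k := one_mul _

/-! ### Reduction of the divergence part to one orthant -/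

lemma exists_le_sum_posBox {n : ℕ} {l : Fin n} {F : (Fin n → ℕ) → ℝ} (h0 : ∀ k, 0 ≤ F k)
    (h : ¬ Summable fun k => if 1 ≤ k l then F k else 0) (B : ℝ) :
    ∃ N, B ≤ ∑ k ∈ posBox l N, F k := by
  by_contra! hc
  refine h (summable_of_sum_le (c := B) (fun k => ?_) fun s => ?_)
  · dsimp only
    split_ifs
    · exact h0 k
    · exact le_rfl
  · refine le_trans ?_ (hc (s.sup fun k => Finset.univ.sup k)).le
    rw [← Finset.sum_filter]
    refine Finset.sum_le_sum_of_subset_of_nonneg (fun k hk => ?_) fun _ _ _ => h0 _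
    rw [Finset.mem_filter] at hk
    rw [mem_posBox]
    refine ⟨fun i => (Finset.le_sup (f := k) (Finset.mem_univ i)).trans ?_, hk.2⟩
    exact Finset.le_sup (f := fun k : Fin n → ℕ => Finset.univ.sup k) hk.1

lemma exists_not_summable_coord {n : ℕ} {F : (Fin n → ℕ) → ℝ} (h0 : ∀ k, 0 ≤ F k)
    (h : ¬ Summable F) : ∃ l : Fin n, ¬ Summable fun k => if 1 ≤ k l then F k else 0 := by
  by_contra! hc
  have h1 : Summable fun k : Fin n → ℕ => if k = 0 then F k else 0 :=
    summable_of_ne_finset_zero (s := {0}) fun k hk => if_neg (by simpa using hk)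
  have h2 := h1.add (summable_sum (s := Finset.univ) fun l _ => hc l)
  refine h (h2.of_nonneg_of_le h0 fun k => ?_)
  have hnn : ∀ l : Fin n, 0 ≤ if 1 ≤ k l then F k else 0 := fun l => by
    split_ifs
    · exact h0 k
    · exact le_rfl
  by_cases hk : k = 0
  · rw [if_pos hk]
    exact le_add_of_nonneg_right (Finset.sum_nonneg fun l _ => hnn l)
  · rw [if_neg hk, zero_add]
    obtain ⟨l, hl⟩ := Function.ne_iff.1 hk
    have hl1 : 1 ≤ k l := Nat.one_le_iff_ne_zero.2 hl
    calc F k = if 1 ≤ k l then F k else 0 := (if_pos hl1).symm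
      _ ≤ _ := Finset.single_le_sum (f := fun l => if 1 ≤ k l then F k else 0)
        (fun l _ => hnn l) (Finset.mem_univ l)

/-- The vector `(σᵢ kᵢ)` of the orthant with signs `σ`. -/
def orthantVec {n : ℕ} (σ : Fin n → ℤˣ) : (Fin n → ℕ) → Fin n → ℤ := scaleVec fun i => σ i

lemma orthantVec_injective {n : ℕ} (σ : Fin n → ℤˣ) : Function.Injective (orthantVec σ) := by
  intro k k' h
  funext i
  have := congrFun h i
  simp only [orthantVec, scaleVec] at this
  exact_mod_cast mul_left_cancel₀ (σ i).ne_zero this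

lemma exists_not_summable_orthant {n : ℕ} {H : (Fin n → ℤ) → ℝ} (h0 : ∀ q, 0 ≤ H q)
    (h : ¬ Summable H) : ∃ σ : Fin n → ℤˣ, ¬ Summable fun k => H (orthantVec σ k) := by
  by_contra! hc
  have h1 : Summable fun p : (Fin n → ℤˣ) × (Fin n → ℕ) => H (orthantVec p.1 p.2) :=
    (summable_prod_of_nonneg fun p => h0 _).2 ⟨hc, (hasSum_fintype _).summable⟩
  let j : (Fin n → ℤ) → (Fin n → ℤˣ) × (Fin n → ℕ) := fun q =>
    (fun i => if 0 ≤ q i then 1 else -1, fun i => (q i).natAbs)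
  have hj : ∀ q, orthantVec (j q).1 (j q).2 = q := fun q => by
    funext i
    simp only [orthantVec, scaleVec, j]
    split_ifs with hi
    · push_cast; rw [abs_of_nonneg hi, one_mul]
    · push_cast; rw [abs_of_neg (not_le.1 hi)]; ring
  have hinj : Function.Injective j := fun q q' hqq => by rw [← hj q, ← hj q', hqq]
  refine h ((h1.comp_injective hinj).congr fun q => ?_)
  simp only [Function.comp_apply, hj]

lemma IsNonincreasing.antitone_orthantVec {n : ℕ} {ψ : (Fin n → ℤ) → ℝ} (hψ : IsNonincreasing ψ)
    (σ : Fin n → ℤˣ) : Antitone fun k => ψ (orthantVec σ k) := by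
  intro k k' h
  refine hψ _ _ fun i => ?_
  have hi : (k i : ℤ) ≤ k' i := by exact_mod_cast h i
  simp only [orthantVec, scaleVec]
  rcases Int.units_eq_one_or (σ i) with hs | hs <;> rw [hs]
  · left; constructor
    · simp
    · simpa using hi
  · right; constructor
    · simpa using hi
    · simp

lemma unitMeasure_eq_restrict_Icc : unitMeasure = volume.restrict (Set.Icc 0 1) :=
  Measure.restrict_congr_set Ico_ae_eq_Icc

lemma matrixMeasure_eq_restrict (m n : ℕ) : matrixMeasure m n = volume.restrict
    (Set.univ.pi fun _ : Fin m => Set.univ.pi fun _ : Fin n => Set.Icc (0 : ℝ) 1) := by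
  have h : cubeMeasure n = volume.restrict (Set.univ.pi fun _ : Fin n => Set.Icc (0 : ℝ) 1) := by
    rw [cubeMeasure, unitMeasure_eq_restrict_Icc, volume_pi, Measure.restrict_pi_pi]
  rw [matrixMeasure, h]
  exact (Measure.restrict_pi_pi (fun _ => volume) _).symm

lemma volume_multSet (n m : ℕ) (ψ : (Fin n → ℤ) → ℝ) :
    volume (multSet n m ψ) = matrixMeasure m n (multLimsup id ψ) := by
  rw [matrixMeasure_eq_restrict, Measure.restrict_apply'
    (MeasurableSet.univ_pi fun _ => MeasurableSet.univ_pi fun _ => measurableSet_Icc)]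
  congr 1
  ext x
  simp only [multSet, multLimsup, Set.mem_inter_iff, Set.mem_univ_pi, Set.mem_ofPred_eq, id]
  exact and_comm

/-- If the truncated series converged, its terms would tend to zero, so truncation would act at only
finitely many indices. -/
lemma not_summable_logWeight_min {ι : Type*} (d : ℕ) {ψ : ι → ℝ}
    (h : ¬ Summable fun q => logWeight d (ψ q)) :
    ¬ Summable fun q => logWeight d (min (ψ q) (logCutoff d)) := by
  intro hs
  have hpos : 0 < logWeight d (logCutoff d) := by
    have := le_log_inv_of_le_logCutoff (logCutoff_pos d) le_rfl
    have hd : (0 : ℝ) ≤ d := d.cast_nonneg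
    exact mul_pos (logCutoff_pos d) (pow_pos (by linarith) d)
  refine h ((summable_congr_cofinite ?_).1 hs)
  filter_upwards [hs.tendsto_cofinite_zero.eventually_lt_const hpos] with q hq
  rcases le_total (ψ q) (logCutoff d) with hle | hle
  · rw [min_eq_left hle]
  · rw [min_eq_right hle] at hq
    exact absurd hq (lt_irrefl _)

theorem volume_multSet_eq_one {n d : ℕ} {ψ : (Fin n → ℤ) → ℝ} (h0 : ∀ q, 0 ≤ ψ q)
    (hψ : IsNonincreasing ψ) (h : ¬ Summable fun q => logWeight d (ψ q)) :
    volume (multSet n (d + 1) ψ) = 1 := by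
  rw [volume_multSet]
  set ψ' : (Fin n → ℤ) → ℝ := fun q => min (ψ q) (logCutoff d) with hψ'
  have hψ'0 : ∀ q, 0 ≤ ψ' q := fun q => le_min (h0 q) (logCutoff_pos d).le
  have hψ'1 : ∀ q, ψ' q ≤ logCutoff d := fun q => min_le_right _ _
  have hH0 : ∀ q, 0 ≤ logWeight d (ψ' q) := fun q =>
    logWeight_nonneg d (hψ'0 q) ((hψ'1 q).trans (logCutoff_lt_one d).le)
  have hψ'n : IsNonincreasing ψ' := fun q q' hqq => min_le_min_right _ (hψ q q' hqq)
  obtain ⟨σ, hσ⟩ := exists_not_summable_orthant hH0 (not_summable_logWeight_min d h)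
  obtain ⟨l, hl⟩ := exists_not_summable_coord (fun k => hH0 (orthantVec σ k)) hσ
  have hone := multLimsup_eq_one (d := d) (σ := fun i => (σ i : ℤ)) (fun i => (σ i).ne_zero) l
    (hψ'n.antitone_orthantVec σ) (fun k => hψ'0 _) (fun k => hψ'1 _)
    (exists_le_sum_posBox (fun k => hH0 (orthantVec σ k)) hl)
  refine le_antisymm prob_le_one (hone.ge.trans (measure_mono fun x hx => ?_))
  refine (Set.Infinite.image (orthantVec_injective σ).injOn hx).mono ?_
  rintro _ ⟨k, hk, rfl⟩
  exact lt_of_lt_of_le (b := ψ' (orthantVec σ k)) hk (min_le_left _ _)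

/-! ### The convergence part -/

lemma IsNonincreasing.le_single {n : ℕ} {ψ : (Fin n → ℤ) → ℝ} (hψ : IsNonincreasing ψ)
    {q : Fin n → ℤ} {l : Fin n} {a : ℤ} (h : (0 ≤ a ∧ a ≤ q l) ∨ (q l ≤ a ∧ a ≤ 0)) :
    ψ q ≤ ψ (Pi.single l a) := by
  refine hψ _ _ fun i => ?_
  by_cases hi : i = l
  · subst hi
    rw [Pi.single_eq_same]
    exact h
  · rw [Pi.single_eq_of_ne hi]
    rcases le_total 0 (q i) with h0 | h0
    · exact Or.inl ⟨le_rfl, h0⟩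
    · exact Or.inr ⟨h0, le_rfl⟩

/-- If `ψ ≤ c` somewhere on each of the `2n` half-axes, monotonicity confines `{c < ψ}` to a bounded
box. -/
lemma IsNonincreasing.exists_axis {n : ℕ} {ψ : (Fin n → ℤ) → ℝ} (hψ : IsNonincreasing ψ) {c : ℝ}
    (h : {q | c < ψ q}.Infinite) :
    ∃ (l : Fin n) (ε : ℤˣ), ∀ t : ℕ, c < ψ (Pi.single l (ε * t)) := by
  by_contra! hc
  choose T hT using hc
  refine h ((Set.finite_Icc (fun l => -(T l (-1) : ℤ)) fun l => (T l 1 : ℤ)).subset fun q hq => ?_)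
  have hq' : c < ψ q := hq
  refine ⟨fun l => ?_, fun l => ?_⟩
  · by_contra! hlt
    have h1 := hT l (-1)
    push_cast at h1
    have h2 := hψ.le_single (q := q) (l := l) (a := -1 * (T l (-1) : ℤ))
      (Or.inr ⟨by linarith, by simp⟩)
    linarith
  · by_contra! hlt
    have h1 := hT l 1
    push_cast at h1
    have h2 := hψ.le_single (q := q) (l := l) (a := 1 * (T l 1 : ℤ))
      (Or.inl ⟨by simp, by linarith⟩)
    linarith

/-- Otherwise `ψ` exceeds the cutoff along a half-axis. There it is eventually below 1 and
non-increasing, so its logarithmic factor stays away from 0 and the terms do not tend to zero. -/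
lemma IsNonincreasing.eventually_le_logCutoff {n d : ℕ} {ψ : (Fin n → ℤ) → ℝ}
    (hψ : IsNonincreasing ψ) (h1 : ∀ᶠ q in Filter.cofinite, ψ q < 1)
    (hs : Summable fun q => logWeight d (ψ q)) :
    ∀ᶠ q in Filter.cofinite, ψ q ≤ logCutoff d := by
  by_contra hc
  have hinf : {q | logCutoff d < ψ q}.Infinite := fun hfin => by
    refine hc (Filter.eventually_cofinite.2 ?_)
    simpa only [not_le] using hfin
  obtain ⟨l, ε, hax⟩ := hψ.exists_axis hinf
  let v : ℕ → Fin n → ℤ := fun t => Pi.single l (ε * t)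
  have hv : Function.Injective v := fun t t' h => by
    have := Pi.single_injective l h
    exact_mod_cast mul_left_cancel₀ ε.ne_zero this
  have hanti : Antitone fun t => ψ (v t) := fun t t' h => by
    refine hψ.le_single ?_
    have ht : (t : ℤ) ≤ t' := by exact_mod_cast h
    simp only [v, Pi.single_eq_same]
    rcases Int.units_eq_one_or ε with hs | hs <;> rw [hs]
    · left; constructor
      · simp
      · simpa using ht
    · right; constructor
      · simpa using ht
      · simp
  have hlt : ∀ᶠ t in Filter.atTop, ψ (v t) < 1 := by
    rw [← Nat.cofinite_eq_atTop]; exact hv.tendsto_cofinite.eventually h1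
  obtain ⟨t₀, ht₀⟩ := hlt.exists
  have hc0 := logCutoff_pos d
  have hψ0 : 0 < ψ (v t₀) := hc0.trans (hax t₀)
  set b := logCutoff d * Real.log (ψ (v t₀))⁻¹ ^ d with hb
  have hlog : 0 < Real.log (ψ (v t₀))⁻¹ := Real.log_pos ((one_lt_inv₀ hψ0).2 ht₀)
  have hb0 : 0 < b := mul_pos hc0 (pow_pos hlog d)
  have hev := (hv.tendsto_cofinite.eventually
    (hs.tendsto_cofinite_zero.eventually_lt_const hb0))
  rw [Nat.cofinite_eq_atTop] at hev
  obtain ⟨t, ht, htt⟩ := (hev.and (Filter.eventually_ge_atTop t₀)).exists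
  refine absurd ht (not_lt.2 ?_)
  have hψt : 0 < ψ (v t) := hc0.trans (hax t)
  have hle : Real.log (ψ (v t₀))⁻¹ ≤ Real.log (ψ (v t))⁻¹ :=
    Real.log_le_log (by positivity) (inv_anti₀ hψt (hanti htt))
  exact mul_le_mul (hax t).le (pow_le_pow_left₀ hlog.le hle d) (by positivity) hψt.le

lemma distNearestInt_fract (t : ℝ) : distNearestInt (Int.fract t) = distNearestInt t := by
  rw [distNearestInt, distNearestInt, abs_sub_round_eq_min, abs_sub_round_eq_min, Int.fract_fract]

lemma distNearestInt_nonneg (t : ℝ) : 0 ≤ distNearestInt t := abs_nonneg _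

lemma distNearestInt_lt_one (t : ℝ) : distNearestInt t < 1 :=
  (abs_sub_round t).trans_lt (by norm_num)

lemma unitMeasure_distNearestInt_lt_le {δ : ℝ} (hδ : 0 ≤ δ) :
    unitMeasure {y | distNearestInt y < δ} ≤ ENNReal.ofReal (2 * δ) := by
  calc unitMeasure {y | distNearestInt y < δ}
      ≤ volume (Set.Ico 0 δ ∪ Set.Ioo (1 - δ) 1) := by
        refine unitMeasure_apply_le _ _ fun y hy h => ?_
        have h' : distNearestInt y < δ := h
        rw [distNearestInt, abs_sub_round_eq_min, Int.fract_eq_self.2 hy, min_lt_iff] at h'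
        rcases h' with h' | h'
        · exact Or.inl ⟨hy.1, h'⟩
        · exact Or.inr ⟨by linarith, hy.2⟩
    _ ≤ volume (Set.Ico 0 δ) + volume (Set.Ioo (1 - δ) 1) := measure_union_le _ _
    _ = ENNReal.ofReal (2 * δ) := by
        rw [Real.volume_Ico, Real.volume_Ioo, ← ENNReal.ofReal_add (by linarith) (by linarith)]
        congr 1; ring

lemma measurable_distNearestInt : Measurable distNearestInt := by
  have : distNearestInt = fun t => min (Int.fract t) (1 - Int.fract t) :=
    funext abs_sub_round_eq_min
  rw [this]
  fun_prop

lemma matrixMeasure_prod_lt_le {n d : ℕ} {q : Fin n → ℤ} (hq : q ≠ 0) {t : ℝ} (h0 : 0 ≤ t)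
    (h1 : t ≤ logCutoff d) :
    matrixMeasure (d + 1) n {x | ∏ j, distNearestInt (intForm q (x j)) < t}
      ≤ ENNReal.ofReal (2 ^ (d + 1) * (2 ^ (d + 1) * 3 ^ d) * logWeight d t) := by
  obtain ⟨i, hi⟩ := Function.ne_iff.1 hq
  let u : (Fin n → ℝ) → ℝ := fun x => distNearestInt (intForm q x)
  have hu0 : ∀ x, 0 ≤ u x := fun x => distNearestInt_nonneg _
  have heq : {x : Fin (d + 1) → Fin n → ℝ | ∏ j, distNearestInt (intForm q (x j)) < t}
      = prodSublevel u t := by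
    ext x
    exact ⟨fun hx => ⟨fun j => distNearestInt_lt_one _, hx⟩, fun hx => hx.2⟩
  rw [heq]
  rcases h0.eq_or_lt with rfl | h0
  · rw [prodSublevel_zero hu0, measure_empty]; exact zero_le
  refine pi_prodSublevel_le (cubeMeasure n) hu0 zero_le_two (fun a => ?_) h0 h1
  have hm : MeasurableSet {y | distNearestInt y < (1 / 2 : ℝ) ^ a} :=
    measurableSet_lt measurable_distNearestInt measurable_const
  have := (measurePreserving_fract_intForm hi).measure_preimage hm.nullMeasurableSet
  simp only [Set.preimage, Set.mem_ofPred_eq, distNearestInt_fract] at this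
  rw [this]
  exact unitMeasure_distNearestInt_lt_le (by positivity)

theorem volume_multSet_eq_zero {n d : ℕ} {ψ : (Fin n → ℤ) → ℝ} (h0 : ∀ q, 0 ≤ ψ q)
    (hψ : IsNonincreasing ψ) (h1 : ∀ᶠ q in Filter.cofinite, ψ q < 1)
    (hs : Summable fun q => logWeight d (ψ q)) : volume (multSet n (d + 1) ψ) = 0 := by
  classical
  rw [volume_multSet]
  have hgood : ∀ᶠ q in Filter.cofinite, q ≠ 0 ∧ ψ q ≤ logCutoff d :=
    (Filter.eventually_cofinite_ne 0).and (hψ.eventually_le_logCutoff h1 hs)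
  set g : Set (Fin n → ℤ) := {q | q ≠ 0 ∧ ψ q ≤ logCutoff d} with hg
  let E : (Fin n → ℤ) → Set (Fin (d + 1) → Fin n → ℝ) := fun q =>
    if q ∈ g then {x | ∏ j, distNearestInt (intForm q (x j)) < ψ q} else ∅
  set C : ℝ := 2 ^ (d + 1) * (2 ^ (d + 1) * 3 ^ d) with hC
  have hE : ∀ q, matrixMeasure (d + 1) n (E q) ≤ ENNReal.ofReal (C * logWeight d (ψ q)) := by
    intro q
    by_cases hq : q ∈ g
    · simp only [E, if_pos hq]
      exact matrixMeasure_prod_lt_le hq.1 (h0 q) hq.2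
    · simp only [E, if_neg hq, measure_empty]
      exact zero_le
  have hsum : ∑' q, matrixMeasure (d + 1) n (E q) ≠ ⊤ :=
    ne_top_of_le_ne_top (hs.mul_left C).tsum_ofReal_ne_top (ENNReal.tsum_le_tsum hE)
  have hae := ae_iff.1 (ae_finite_setOfPred_mem hsum)
  refine measure_mono_null (fun x hx => ?_) hae
  rw [Set.mem_ofPred_eq]
  intro hfin
  refine hx ((hfin.union (Filter.eventually_cofinite.1 hgood)).subset fun q hq => ?_)
  by_cases hqg : q ∈ g
  · left
    change x ∈ E q
    simp only [E, if_pos hqg]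
    exact hq
  · exact Or.inr hqg

/-! ### The counterexample -/

/-- An approximating function violating the criterion with `ψⁿ` in place of `ψ`. -/
noncomputable def invProd (n : ℕ) (q : Fin n → ℤ) : ℝ := ∏ i, (2 + |(q i : ℝ)|)⁻¹

lemma inv_two_add_abs_pos (a : ℝ) : 0 < (2 + |a|)⁻¹ := by positivity

lemma inv_two_add_abs_le (a : ℝ) : (2 + |a|)⁻¹ ≤ 1 / 2 := by
  rw [one_div]; exact inv_anti₀ (by norm_num) (by linarith [abs_nonneg a])

lemma invProd_pos (n : ℕ) (q : Fin n → ℤ) : 0 < invProd n q :=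
  Finset.prod_pos fun _ _ => inv_two_add_abs_pos _

lemma invProd_le_half {n : ℕ} (hn : 1 ≤ n) (q : Fin n → ℤ) : invProd n q ≤ 1 / 2 := by
  obtain ⟨k, rfl⟩ := Nat.exists_eq_add_of_le' hn
  rw [invProd, Fin.prod_univ_succ]
  have h1 : ∏ i : Fin k, (2 + |(q i.succ : ℝ)|)⁻¹ ≤ 1 :=
    Finset.prod_le_one (fun _ _ => (inv_two_add_abs_pos _).le) fun _ _ =>
      (inv_two_add_abs_le _).trans (by norm_num)
  calc _ ≤ (2 + |(q 0 : ℝ)|)⁻¹ * 1 := mul_le_mul_of_nonneg_left h1 (inv_two_add_abs_pos _).le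
    _ ≤ 1 / 2 := by rw [mul_one]; exact inv_two_add_abs_le _

lemma isNonincreasing_invProd (n : ℕ) : IsNonincreasing (invProd n) := by
  intro q q' h
  refine Finset.prod_le_prod (fun _ _ => (inv_two_add_abs_pos _).le) fun i _ => ?_
  refine inv_anti₀ (by positivity) (add_le_add_right ?_ 2)
  have : |q i| ≤ |q' i| := by
    rcases h i with ⟨h1, h2⟩ | ⟨h1, h2⟩
    · rw [abs_of_nonneg h1, abs_of_nonneg (h1.trans h2)]; exact h2
    · rw [abs_of_nonpos h2, abs_of_nonpos (h1.trans h2)]; exact neg_le_neg h1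
  exact_mod_cast this

lemma summable_prod_of_summable {n : ℕ} {f : ℤ → ℝ} (h0 : ∀ a, 0 ≤ f a) (hf : Summable f) :
    Summable fun q : Fin n → ℤ => ∏ i, f (q i) := by
  classical
  refine summable_of_sum_le (c := (∑' a, f a) ^ n)
    (fun q => Finset.prod_nonneg fun i _ => h0 _) fun s => ?_
  let S : Finset ℤ := s.biUnion fun q => Finset.univ.image q
  calc ∑ q ∈ s, ∏ i, f (q i) ≤ ∑ q ∈ Fintype.piFinset fun _ : Fin n => S, ∏ i, f (q i) := by
        refine Finset.sum_le_sum_of_subset_of_nonneg (fun q hq => ?_)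
          fun q _ _ => Finset.prod_nonneg fun i _ => h0 _
        rw [Fintype.mem_piFinset]
        intro i
        exact Finset.mem_biUnion.2 ⟨q, hq, Finset.mem_image_of_mem q (Finset.mem_univ i)⟩
    _ = (∑ a ∈ S, f a) ^ n := by
        rw [Finset.sum_prod_piFinset S fun _ a => f a]; simp
    _ ≤ _ := pow_le_pow_left₀ (Finset.sum_nonneg fun _ _ => h0 _)
        (hf.sum_le_tsum S fun _ _ => h0 _) n

lemma summable_two_add_abs_rpow : Summable fun a : ℤ => ((2 + |(a : ℝ)|)⁻¹) ^ (3 / 2 : ℝ) := by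
  have hnat : Summable fun a : ℕ => ((2 + (a : ℝ))⁻¹) ^ (3 / 2 : ℝ) := by
    have h := (summable_nat_add_iff 2).2
      (Real.summable_nat_rpow_inv.2 (by norm_num : (1 : ℝ) < 3 / 2))
    refine h.congr fun a => ?_
    rw [Real.inv_rpow (by positivity)]
    push_cast
    rw [add_comm]
  refine Summable.of_nat_of_neg (hnat.congr fun a => ?_) (hnat.congr fun a => ?_)
  · simp
  · simp

lemma log_inv_pow_le (d : ℕ) {t : ℝ} (h0 : 0 < t) (h1 : t ≤ 1) :
    Real.log t⁻¹ ^ d ≤ (2 * (d + 1)) ^ d * t ^ (-(1 / 2) : ℝ) := by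
  have hd : (0 : ℝ) < 2 * (d + 1) := by positivity
  -- The exponent is chosen so that its `d`-fold multiple is at most `1/2`; using `d + 1` keeps it
  -- defined for `d = 0`.
  have h2 : Real.log t⁻¹ ≤ (2 * (d + 1)) * t⁻¹ ^ (1 / (2 * (d + 1)) : ℝ) := by
    have := Real.log_le_rpow_div (x := t⁻¹) (ε := 1 / (2 * (d + 1))) (by positivity) (by positivity)
    rwa [div_div_eq_mul_div, div_one, mul_comm] at this
  calc Real.log t⁻¹ ^ d ≤ ((2 * (d + 1)) * t⁻¹ ^ (1 / (2 * (d + 1)) : ℝ)) ^ d :=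
        pow_le_pow_left₀ (log_inv_nonneg h0.le h1) h2 d
    _ = (2 * (d + 1)) ^ d * t⁻¹ ^ (1 / (2 * (d + 1)) * d : ℝ) := by
        rw [mul_pow, ← Real.rpow_mul_natCast (by positivity)]
    _ ≤ (2 * (d + 1)) ^ d * t⁻¹ ^ (1 / 2 : ℝ) := by
        refine mul_le_mul_of_nonneg_left ?_ (by positivity)
        refine Real.rpow_le_rpow_of_exponent_le ((one_le_inv₀ h0).2 h1) ?_
        rw [div_mul_eq_mul_div, div_le_div_iff₀ hd (by norm_num)]
        linarith
    _ = _ := by rw [Real.inv_rpow h0.le, Real.rpow_neg h0.le]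

/-- As `n ≥ 2`, the term is at most a constant times `t^2 t^(-1/2) = t^(3/2)`, which factors into
convergent one-variable series. -/
lemma summable_invProd_pow {n : ℕ} (hn : 2 ≤ n) (d : ℕ) :
    Summable fun q => invProd n q ^ n * Real.log (invProd n q)⁻¹ ^ d := by
  have h := (summable_prod_of_summable (n := n)
    (fun a => Real.rpow_nonneg (inv_two_add_abs_pos _).le _) summable_two_add_abs_rpow).mul_left
      ((2 * ((d : ℝ) + 1)) ^ d)
  have h1 : ∀ q, invProd n q ≤ 1 := fun q => (invProd_le_half (by omega) q).trans (by norm_num)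
  refine h.of_nonneg_of_le (fun q => ?_) fun q => ?_
  · exact mul_nonneg (pow_nonneg (invProd_pos n q).le n)
      (pow_nonneg (log_inv_nonneg (invProd_pos n q).le (h1 q)) d)
  · set t := invProd n q with ht
    have ht0 : 0 < t := invProd_pos n q
    have hprod : ∏ i, ((2 + |(q i : ℝ)|)⁻¹) ^ (3 / 2 : ℝ) = t ^ (3 / 2 : ℝ) :=
      Real.finsetProd_rpow _ _ (fun i _ => (inv_two_add_abs_pos _).le) _
    rw [hprod]
    calc t ^ n * Real.log t⁻¹ ^ d ≤ t ^ 2 * ((2 * (d + 1)) ^ d * t ^ (-(1 / 2) : ℝ)) :=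
          mul_le_mul (pow_le_pow_of_le_one ht0.le (h1 q) hn) (log_inv_pow_le d ht0 (h1 q))
            (pow_nonneg (log_inv_nonneg ht0.le (h1 q)) d) (by positivity)
      _ = (2 * (d + 1)) ^ d * (t ^ (2 : ℝ) * t ^ (-(1 / 2) : ℝ)) := by
          rw [← Real.rpow_natCast t 2]; push_cast; ring
      _ = _ := by rw [← Real.rpow_add ht0]; norm_num

/-- On one axis the terms dominate a multiple of the harmonic series, since the logarithm is at
least `log 2`. -/
lemma not_summable_invProd {n : ℕ} (hn : 1 ≤ n) (d : ℕ) :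
    ¬ Summable fun q => logWeight d (invProd n q) := by
  obtain ⟨k, rfl⟩ := Nat.exists_eq_add_of_le' hn
  intro hs
  let v : ℕ → Fin (k + 1) → ℤ := fun a => Pi.single 0 (a : ℤ)
  have hv : Function.Injective v := fun a b h => by
    exact_mod_cast Pi.single_injective (0 : Fin (k + 1)) h
  have hval : ∀ a, invProd (k + 1) (v a) = (2 + (a : ℝ))⁻¹ * (1 / 2) ^ k := fun a => by
    rw [invProd, Fin.prod_univ_succ]
    simp [v, Fin.succ_ne_zero]
  have h1 := hs.comp_injective hv
  have hlog : 0 < Real.log 2 := Real.log_pos (by norm_num)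
  have h2 : Summable fun a : ℕ => (1 / 2 : ℝ) ^ k * Real.log 2 ^ d * (2 + (a : ℝ))⁻¹ := by
    refine h1.of_nonneg_of_le (fun a => by positivity) fun a => ?_
    simp only [Function.comp_apply, logWeight]
    have hle : Real.log 2 ≤ Real.log (invProd (k + 1) (v a))⁻¹ := by
      refine Real.log_le_log (by norm_num) ?_
      rw [le_inv_comm₀ (by norm_num) (invProd_pos _ _)]
      simpa using invProd_le_half hn (v a)
    calc (1 / 2 : ℝ) ^ k * Real.log 2 ^ d * (2 + (a : ℝ))⁻¹
        = invProd (k + 1) (v a) * Real.log 2 ^ d := by rw [hval]; ring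
      _ ≤ _ := mul_le_mul_of_nonneg_left (pow_le_pow_left₀ hlog.le hle d) (invProd_pos _ _).le
  rw [summable_mul_left_iff (by positivity)] at h2
  refine Real.not_summable_natCast_inv ((summable_nat_add_iff 2).1 (h2.congr fun a => ?_))
  push_cast
  rw [add_comm]

theorem theorem1p7 (n m : ℕ) (hn : 1 ≤ n) (hm : 1 ≤ m) :
    (∀ ψ : (Fin n → ℤ) → ℝ, (∀ q, 0 ≤ ψ q) → IsNonincreasing ψ →
      ((∀ᶠ q in Filter.cofinite, ψ q < 1) →
        Summable (fun q => ψ q * Real.log (ψ q)⁻¹ ^ (m - 1)) →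
        volume (multSet n m ψ) = 0) ∧
      (¬ Summable (fun q => ψ q * Real.log (ψ q)⁻¹ ^ (m - 1)) →
        volume (multSet n m ψ) = 1)) ∧
    (2 ≤ n → ∃ ψ : (Fin n → ℤ) → ℝ, (∀ q, 0 < ψ q ∧ ψ q < 1) ∧ IsNonincreasing ψ ∧
      Summable (fun q => ψ q ^ n * Real.log (ψ q)⁻¹ ^ (m - 1)) ∧
      volume (multSet n m ψ) = 1) := by
  obtain ⟨d, rfl⟩ := Nat.exists_eq_add_of_le' hm
  rw [Nat.add_sub_cancel]
  refine ⟨fun ψ h0 hψ => ⟨fun h1 hs => volume_multSet_eq_zero h0 hψ h1 hs,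
    fun hs => volume_multSet_eq_one h0 hψ hs⟩, fun h2 => ⟨invProd n, fun q => ⟨invProd_pos n q,
      (invProd_le_half hn q).trans_lt (by norm_num)⟩, isNonincreasing_invProd n,
      summable_invProd_pow h2 d, ?_⟩⟩
  exact volume_multSet_eq_one (fun q => (invProd_pos n q).le) (isNonincreasing_invProd n)
    (not_summable_invProd hn d)
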